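/- Let $n\ge 0$. A weak composition of length $n$ is a sequence $\alpha=(\alpha_1,\dots,\alpha_n)$ of nonnegative integers, and $x^\alpha=x_1^{\alpha_1}\cdots x_n^{\alpha_n}$. **Fundamental Demazure atoms.** For $1\le i<n$ let $\tilde s_i$ be the linear operator on $\mathbb{C}[x_1,\dots,x_n]$ that sends $x^\alpha$ to the monomial obtained by exchanging the exponents $\alpha_i$ and $\alpha_{i+1}$ if $\alpha_i=0$ or $\alpha_{i+1}=0$, and fixes $x^\alpha$ otherwise. Put $$\tilde\partial_i f=\frac{f-\tilde s_i f}{x_i-x_{i+1}},\qquad \tilde\theta_i f=x_{i+1}\,\tilde\partial_i f,$$ and $\tilde\theta_w=\tilde\theta_{i_1}\cdots\tilde\theta_{i_k}$ for a reduced word $w=s_{i_1}\cdots s_{i_k}$ of $w\in S_n$. Let $\operatorname{flat}(\alpha)$ be obtained from $\alpha$ by moving all zeros to the right end, keeping the order of the other entries, and let $w_\alpha\in S_n$ be the permutation of minimal length with $w_\alpha(\alpha)=\operatorname{flat}(\alpha)$. The fundamental Demazure atom (fundamental particle) is $\tilde{\mathcal A}_\alpha=\tilde\theta_{w_\alpha^{-1}}\,x^{\operatorname{flat}(\alpha)}$.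 **Fundamental atom multiset partitions.** Consider letters of value $i\in\{1,\dots,n\}$, each possibly barred and possibly circled, ordered by $$\textcircled{1}<\overline{\textcircled{1}}<1<\overline{1}<\textcircled{2}<\overline{\textcircled{2}}<2<\overline{2}<\cdots .$$ For a weak composition $\gamma$ of length $n$ and a position $i$, let $j(\gamma,i)=p+1$, where $p<i$ is the largest position to the left of $i$ with $\gamma_p\ne 0$, and $j(\gamma,i)=1$ if there is no such $p$. For weak compositions $\alpha,\beta$ of length $n$, let $\operatorname{qamp}(\alpha,\beta)$ be the set of all sequences $S=(S_1,\dots,S_n)$ of (possibly empty) finite multisets of letters such that: 1. $S_1\cup\dots\cup S_n$ (union with multiplicities) is the multiset that contains, for each $i$ with $\alpha_i\neq0$, the letter $\overline{i}$ with multiplicity $\alpha_i-1$ and $\overline{\textcircled{i}}$ once, and, for each $i$ with $\beta_i\ne0$, the letter $i$ with multiplicity $\beta_i-1$ and $\textcircled{i}$ once, and no other letters. 2. The letters $\overline{i}$ and $\overline{\textcircled{i}}$ occur only in $S_{j(\alpha,i)},\dots,S_i$, and the letters $i$ and $\textcircled{i}$ occur only in $S_{j(\beta,i)},\dots,S_i$.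 3. If only one of $\overline{\textcircled{i}}$ and $\textcircled{i}$ exists, it is in $S_i$. If both exist, then $\overline{\textcircled{i}}$ is in $S_i$, and if $\textcircled{i}$ is in $S_j$ with $j<i$, then $j\ge j(\alpha,i)$ and every uncircled letter of value $i$ is in some $S_k$ with $k\le j$. 4. If the elements of each $S_p$ are listed in weakly decreasing order, then the last letter of each nonempty $S_p$ is strictly smaller than the first letter of the next nonempty $S_q$, $q>p$ (if there is one). For $S\in\operatorname{qamp}(\alpha,\beta)$ let $\operatorname{wt}(S)=(|S_1|,\dots,|S_n|)$, and let $\operatorname{sgn}S$ be the number of $i$ such that $\textcircled{i}$ lies in a set strictly to the left of the set that contains $\overline{\textcircled{i}}$. **Theorem.** Let $\alpha$ and $\beta$ be weak compositions of length $n$. Then $$\tilde{\mathcal A}_\alpha\cdot\tilde{\mathcal A}_\beta=\sum_{S\in\operatorname{qamp}(\alpha,\beta)}(-1)^{\operatorname{sgn}S}\,\tilde{\mathcal A}_{\operatorname{wt}(S)},$$ and this (finite) sum is cancellation free: if $S,T\in\operatorname{qamp}(\alpha,\beta)$ and $\operatorname{wt}(S)=\operatorname{wt}(T)$, then $(-1)^{\operatorname{sgn}S}=(-1)^{\operatorname{sgn}T}$.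 -/

import Mathlib

namespace FundamentalAtom

open MvPolynomial

/-! ### Weak compositions of length `n`: functions `Fin n → ℕ` (positions are numbered from `0`) -/

/-- The positions `i` such that both `i` and `i + 1` are positions. -/
abbrev AdjPos (n : ℕ) : Type := {i : Fin n // i.val + 1 < n}

/-- The right neighbour `i + 1` of `i`. -/
def AdjPos.right {n : ℕ} (i : AdjPos n) : Fin n := ⟨i.1.val + 1, i.2⟩

theorem AdjPos.ne_right {n : ℕ} (i : AdjPos n) : i.1 ≠ i.right := by
  intro h
  have h2 := congrArg Fin.val h
  simp [AdjPos.right] at h2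

/-- The simple transposition exchanging `i` and `i + 1`. -/
def simpleTransposition {n : ℕ} (i : AdjPos n) : Equiv.Perm (Fin n) :=
  Equiv.swap i.1 i.right

/-! ### The quasisymmetric divided difference operators -/

/-- The quasisymmetric action of the `i`-th simple transposition on exponent vectors: positions `i`
and `i + 1` are exchanged if at least one of the two entries is zero; otherwise nothing happens. -/
noncomputable def quasiSwapExp {n : ℕ} (i : AdjPos n) (m : Fin n →₀ ℕ) : Fin n →₀ ℕ :=
  if m i.1 = 0 ∨ m i.right = 0 then m.mapDomain (simpleTransposition i) else m

/-- The linear extension of `quasiSwapExp` to polynomials. -/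
noncomputable def quasiSwap {n : ℕ} (i : AdjPos n) :
    MvPolynomial (Fin n) ℂ →ₗ[ℂ] MvPolynomial (Fin n) ℂ :=
  (basisMonomials (Fin n) ℂ).constr ℂ fun m => monomial (quasiSwapExp i m) 1

theorem quasiSwap_monomial {n : ℕ} (i : AdjPos n) (m : Fin n →₀ ℕ) (c : ℂ) :
    quasiSwap i (monomial m c) = monomial (quasiSwapExp i m) c := by
  have h1 : quasiSwap i (monomial m 1) = monomial (quasiSwapExp i m) 1 := by
    have := (basisMonomials (Fin n) ℂ).constr_basis ℂ
      (fun m => monomial (quasiSwapExp i m) (1 : ℂ)) m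
    simpa [quasiSwap] using this
  have h2 : (monomial m c : MvPolynomial (Fin n) ℂ) = c • monomial m 1 := by
    simp [smul_monomial]
  rw [h2, map_smul, h1, smul_monomial, smul_eq_mul, mul_one]

theorem dvd_sub_rename_swap {n : ℕ} (a b : Fin n) (f : MvPolynomial (Fin n) ℂ) :
    (X a - X b : MvPolynomial (Fin n) ℂ) ∣ f - rename (Equiv.swap a b) f := by
  rw [← Ideal.mem_span_singleton, ← Ideal.Quotient.eq]
  set I : Ideal (MvPolynomial (Fin n) ℂ) := Ideal.span {X a - X b}
  have hab : Ideal.Quotient.mkₐ ℂ I (X a) = Ideal.Quotient.mkₐ ℂ I (X b) := by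
    simp only [Ideal.Quotient.mkₐ_eq_mk]
    rw [Ideal.Quotient.eq]
    exact Ideal.mem_span_singleton_self _
  have h : Ideal.Quotient.mkₐ ℂ I =
      (Ideal.Quotient.mkₐ ℂ I).comp (rename (Equiv.swap a b)) := by
    apply MvPolynomial.algHom_ext
    intro c
    simp only [AlgHom.comp_apply, rename_X]
    rcases eq_or_ne c a with rfl | hca
    · rw [Equiv.swap_apply_left, hab]
    · rcases eq_or_ne c b with rfl | hcb
      · rw [Equiv.swap_apply_right, hab]
      · rw [Equiv.swap_apply_of_ne_of_ne hca hcb]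
  exact DFunLike.congr_fun h f

theorem dvd_sub_quasiSwap {n : ℕ} (i : AdjPos n) (f : MvPolynomial (Fin n) ℂ) :
    (X i.1 - X i.right : MvPolynomial (Fin n) ℂ) ∣ f - quasiSwap i f := by
  induction f using MvPolynomial.induction_on' with
  | monomial m c =>
    rw [quasiSwap_monomial, quasiSwapExp]
    split_ifs with h
    · have := dvd_sub_rename_swap i.1 i.right (monomial m c)
      rwa [rename_monomial] at this
    · simp
  | add p q hp hq =>
    have : p + q - quasiSwap i (p + q) = (p - quasiSwap i p) + (q - quasiSwap i q) := by
      rw [map_add]; ring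
    rw [this]
    exact dvd_add hp hq

/-- The quasisymmetric divided difference `(f - s̃ᵢ f) / (xᵢ - xᵢ₊₁)`: the unique polynomial `q` with
`f - s̃ᵢ f = (xᵢ - xᵢ₊₁) q`. -/
noncomputable def quasiDiff {n : ℕ} (i : AdjPos n) (f : MvPolynomial (Fin n) ℂ) :
    MvPolynomial (Fin n) ℂ :=
  Classical.choose (dvd_sub_quasiSwap i f)

theorem quasiDiff_spec {n : ℕ} (i : AdjPos n) (f : MvPolynomial (Fin n) ℂ) :
    f - quasiSwap i f = (X i.1 - X i.right) * quasiDiff i f :=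
  Classical.choose_spec (dvd_sub_quasiSwap i f)

/-- `θ̃ᵢ f = xᵢ₊₁ ∂̃ᵢ f`. -/
noncomputable def quasiTheta {n : ℕ} (i : AdjPos n) (f : MvPolynomial (Fin n) ℂ) :
    MvPolynomial (Fin n) ℂ :=
  X i.right * quasiDiff i f

/-- `θ̃` of a word: `θ̃_{i₁} (θ̃_{i₂} (⋯ (θ̃_{iₖ} f)))`. -/
noncomputable def quasiThetaWord {n : ℕ} (l : List (AdjPos n)) (f : MvPolynomial (Fin n) ℂ) :
    MvPolynomial (Fin n) ℂ :=
  l.foldr quasiTheta f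

/-! ### Reduced words and the fundamental Demazure atoms -/

/-- The product `s_{i₁} ⋯ s_{iₖ}` of a word. -/
def wordProd {n : ℕ} (l : List (AdjPos n)) : Equiv.Perm (Fin n) :=
  (l.map simpleTransposition).prod

theorem exists_word {n : ℕ} (w : Equiv.Perm (Fin n)) : ∃ l : List (AdjPos n), wordProd l = w := by
  cases n with
  | zero => exact ⟨[], Subsingleton.elim _ _⟩
  | succ n =>
    have hw : w ∈ Submonoid.closure
        (Set.range fun i : Fin n => Equiv.swap i.castSucc i.succ) := by
      rw [Equiv.Perm.mclosure_swap_castSucc_succ]; trivial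
    induction hw using Submonoid.closure_induction with
    | mem x hx =>
      obtain ⟨i, rfl⟩ := hx
      refine ⟨[⟨i.castSucc, by simp⟩], ?_⟩
      simp [wordProd, simpleTransposition, AdjPos.right, Fin.succ, Fin.castSucc]
    | one => exact ⟨[], rfl⟩
    | mul x y _ _ hx hy =>
      obtain ⟨l, rfl⟩ := hx
      obtain ⟨k, rfl⟩ := hy
      exact ⟨l ++ k, by simp [wordProd]⟩

/-- `l` is a reduced word of `w`. -/
def IsReducedWord {n : ℕ} (l : List (AdjPos n)) (w : Equiv.Perm (Fin n)) : Prop :=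
  wordProd l = w ∧ ∀ k : List (AdjPos n), wordProd k = w → l.length ≤ k.length

theorem exists_reducedWord {n : ℕ} (w : Equiv.Perm (Fin n)) :
    ∃ l : List (AdjPos n), IsReducedWord l w := by
  obtain ⟨l, hl, hmin⟩ := (WellFounded.wellFounded_iff_has_min.mp
    (measure (fun l : List (AdjPos n) => l.length)).wf) {l | wordProd l = w} (exists_word w)
  exact ⟨l, hl, fun k hk => not_lt.mp (hmin k hk)⟩

/-- A reduced word of `w`. -/
noncomputable def reducedWord {n : ℕ} (w : Equiv.Perm (Fin n)) : List (AdjPos n) :=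
  Classical.choose (exists_reducedWord w)

/-- The length of a permutation. -/
noncomputable def permLength {n : ℕ} (w : Equiv.Perm (Fin n)) : ℕ := (reducedWord w).length

/-- The permutation `w` applied to `α`, moving the entry in position `p` to position `w p`. -/
def permute {n : ℕ} (w : Equiv.Perm (Fin n)) (α : Fin n → ℕ) : Fin n → ℕ := fun p => α (w⁻¹ p)

/-- The flat of `α`: all zeros are moved to the right end, keeping the order of the other entries. -/
def flat {n : ℕ} (α : Fin n → ℕ) : Fin n → ℕ :=
  fun p => ((List.ofFn α).filter (fun a => a ≠ 0)).getD p.val 0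

theorem ofFn_flat_perm {n : ℕ} (α : Fin n → ℕ) : (List.ofFn (flat α)).Perm (List.ofFn α) := by
  set L := List.ofFn α with hL
  have hlen : L.length = n := by simp [hL]
  have h1 : List.ofFn (flat α) = L.filter (fun a => a ≠ 0) ++ L.filter (fun a => ¬ a ≠ 0) := by
    have hsum : (L.filter (fun a => a ≠ 0)).length + (L.filter (fun a => ¬ a ≠ 0)).length = n := by
      rw [← List.length_append, ← hlen]
      simpa using (List.filter_append_perm (fun a => decide (a ≠ 0)) L).length_eq
    apply List.ext_getElem
    · simp only [List.length_ofFn, List.length_append]; omega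
    · intro k hk hk'
      simp only [List.getElem_ofFn, flat, ← hL]
      by_cases hlt : k < (L.filter (fun a => a ≠ 0)).length
      · rw [List.getElem_append_left hlt, List.getD_eq_getElem _ _ hlt]
      · rw [List.getElem_append_right (not_lt.mp hlt), List.getD_eq_default _ _ (not_lt.mp hlt)]
        have hmem := List.getElem_mem (l := L.filter (fun a => ¬ a ≠ 0))
          (n := k - (L.filter (fun a => a ≠ 0)).length)
          (by simp only [List.length_append] at hk'; omega)
        exact (not_not.mp (of_decide_eq_true (List.mem_filter.mp hmem).2)).symm
  rw [h1]
  simpa using List.filter_append_perm (fun a => decide (a ≠ 0)) L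

theorem exists_permute_eq_flat {n : ℕ} (α : Fin n → ℕ) :
    ∃ w : Equiv.Perm (Fin n), permute w α = flat α := by
  have h : α ∘ Tuple.sort α = flat α ∘ Tuple.sort (flat α) := by
    apply List.ofFn_injective
    refine List.Perm.eq_of_pairwise' (r := (· ≤ ·)) ?_ ?_ ?_
    · exact (Tuple.monotone_sort α).sortedLE_ofFn.pairwise
    · exact (Tuple.monotone_sort (flat α)).sortedLE_ofFn.pairwise
    · exact ((Equiv.Perm.ofFn_comp_perm _ α).trans (ofFn_flat_perm α).symm).trans
        (Equiv.Perm.ofFn_comp_perm _ (flat α)).symm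
  refine ⟨Tuple.sort (flat α) * (Tuple.sort α)⁻¹, ?_⟩
  funext p
  have := congrFun h ((Tuple.sort (flat α))⁻¹ p)
  simpa [permute] using this

theorem exists_straightening {n : ℕ} (α : Fin n → ℕ) :
    ∃ w : Equiv.Perm (Fin n), permute w α = flat α ∧
      ∀ v : Equiv.Perm (Fin n), permute v α = flat α → permLength w ≤ permLength v := by
  obtain ⟨w, hw, hmin⟩ := (WellFounded.wellFounded_iff_has_min.mp
    (measure (fun w : Equiv.Perm (Fin n) => permLength w)).wf)
    {w | permute w α = flat α} (exists_permute_eq_flat α)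
  exact ⟨w, hw, fun v hv => not_lt.mp (hmin v hv)⟩

/-- The permutation `w_α` of minimal length with `w_α(α) = flat(α)`. -/
noncomputable def straightening {n : ℕ} (α : Fin n → ℕ) : Equiv.Perm (Fin n) :=
  Classical.choose (exists_straightening α)

/-- The fundamental Demazure atom `Ã_α = θ̃_{w_α⁻¹} x^{flat(α)}`, a polynomial in `n` variables. -/
noncomputable def atom {n : ℕ} (α : Fin n → ℕ) : MvPolynomial (Fin n) ℂ :=
  quasiThetaWord (reducedWord (straightening α)⁻¹)
    (monomial (Finsupp.equivFunOnFinite.symm (flat α)) 1)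

/-! ### Fundamental atom multiset partitions -/

/-- A positive integer (here: a position), possibly barred, possibly circled. -/
@[ext]
structure Letter (n : ℕ) where
  value : Fin n
  barred : Bool
  circled : Bool

/-- The place of a letter in the order in which circled `i`, circled barred `i`, `i`, barred `i`
follow each other, and these are followed by circled `i + 1`, and so on. -/
def Letter.rank {n : ℕ} (x : Letter n) : ℕ :=
  4 * x.value.val + (if x.circled then 0 else 2) + (if x.barred then 1 else 0)

theorem Letter.rank_injective {n : ℕ} : Function.Injective (Letter.rank (n := n)) := by
  rintro ⟨v, b, c⟩ ⟨v', b', c'⟩ h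
  have : v.val = v'.val ∧ b = b' ∧ c = c' := by
    cases b <;> cases c <;> cases b' <;> cases c' <;> simp [Letter.rank] at h ⊢ <;> omega
  obtain ⟨h1, rfl, rfl⟩ := this
  rw [Fin.ext h1]

noncomputable instance letterOrder {n : ℕ} : LinearOrder (Letter n) :=
  LinearOrder.lift' Letter.rank Letter.rank_injective

/-- The letter `i`. -/
def plain {n : ℕ} (i : Fin n) : Letter n := ⟨i, false, false⟩

/-- The letter circled `i`. -/
def circ {n : ℕ} (i : Fin n) : Letter n := ⟨i, false, true⟩

/-- The letter barred `i`. -/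
def bar {n : ℕ} (i : Fin n) : Letter n := ⟨i, true, false⟩

/-- The letter circled barred `i`. -/
def circBar {n : ℕ} (i : Fin n) : Letter n := ⟨i, true, true⟩

/-- The multiset that is partitioned: for every `i` with `α i ≠ 0` it has `α i` barred letters of
value `i`, one of them circled; for every `i` with `β i ≠ 0` it has `β i` unbarred letters of value
`i`, one of them circled. -/
def content {n : ℕ} (α β : Fin n → ℕ) : Multiset (Letter n) :=
  (∑ i, if α i ≠ 0 then Multiset.replicate (α i - 1) (bar i) + {circBar i} else 0) +
  (∑ i, if β i ≠ 0 then Multiset.replicate (β i - 1) (plain i) + {circ i} else 0)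

/-- The position `j(γ, i)` right after the nearest nonzero entry of `γ` strictly to the left of `i`,
and the first position `0` if there is no such entry. -/
def leftBound {n : ℕ} (γ : Fin n → ℕ) (i : Fin n) : ℕ :=
  (Finset.univ.filter fun p : Fin n => p < i ∧ γ p ≠ 0).sup fun p => p.val + 1

/-- `S` is a fundamental atom multiset partition of type `α`, `β`. -/
structure IsAtomPartition {n : ℕ} (α β : Fin n → ℕ) (S : Fin n → Multiset (Letter n)) : Prop where
  /-- `S` partitions the multiset `content α β` (parts may be empty). -/
  partition : ∑ p, S p = content α β
  /-- Barred letters of value `i` occur only in positions `j(α, i), …, i`. -/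
  barred_range : ∀ p, ∀ x ∈ S p, x.barred = true → leftBound α x.value ≤ p.val ∧ p ≤ x.value
  /-- Unbarred letters of value `i` occur only in positions `j(β, i), …, i`. -/
  unbarred_range : ∀ p, ∀ x ∈ S p, x.barred = false → leftBound β x.value ≤ p.val ∧ p ≤ x.value
  /-- If circled barred `i` exists, then it is in `S i`. -/
  circBar_mem : ∀ i, α i ≠ 0 → circBar i ∈ S i
  /-- If circled `i` exists and circled barred `i` does not, then circled `i` is in `S i`. -/
  circ_mem : ∀ i, α i = 0 → β i ≠ 0 → circ i ∈ S i
  /-- If both exist and circled `i` is in `S j` with `j < i`, then `j(α, i) ≤ j`, and all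
  uncircled letters of value `i` are in positions weakly left of `j`. -/
  circ_moved : ∀ i j, α i ≠ 0 → β i ≠ 0 → j < i → circ i ∈ S j →
    leftBound α i ≤ j.val ∧
      ∀ k, ∀ x ∈ S k, x.value = i → x ≠ circ i → x ≠ circBar i → k ≤ j
  /-- With each part listed in weakly decreasing order, there is an ascent from the last letter of
  each nonempty part to the first letter of the next nonempty part. -/
  ascent : ∀ p q, p < q → S p ≠ 0 → S q ≠ 0 → (∀ r, p < r → r < q → S r = 0) →
    ∃ x ∈ S p, ∃ y ∈ S q, (∀ z ∈ S p, x ≤ z) ∧ (∀ z ∈ S q, z ≤ y) ∧ x < y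

/-- The set of all fundamental atom multiset partitions of type `α`, `β`. -/
def qamp {n : ℕ} (α β : Fin n → ℕ) : Set (Fin n → Multiset (Letter n)) :=
  {S | IsAtomPartition α β S}

theorem qamp_finite {n : ℕ} (α β : Fin n → ℕ) : (qamp α β).Finite := by
  refine (Set.Finite.pi' (t := fun _ : Fin n => Set.Iic (content α β))
    fun _ => Set.finite_Iic _).subset ?_
  intro S hS p
  rw [Set.mem_Iic, ← hS.partition]
  exact Finset.single_le_sum (f := S) (fun _ _ => Multiset.zero_le _) (Finset.mem_univ p)

/-- The number of `i` such that circled `i` is in a part to the left of the part that contains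
circled barred `i`. -/
noncomputable def sgn {n : ℕ} (S : Fin n → Multiset (Letter n)) : ℕ :=
  {i : Fin n | ∃ p q, p < q ∧ circ i ∈ S p ∧ circBar i ∈ S q}.ncard

/-- The weak composition of the sizes of the parts. -/
def wt {n : ℕ} (S : Fin n → Multiset (Letter n)) : Fin n → ℕ := fun p => (S p).card

end FundamentalAtom

/-! Everything is reduced to a comparison of coefficients. The atom of `c` is the multiplicity-free
sum of the monomials whose exponents refine `c`: every nonzero entry is spread over its own
position, where something must remain, and the zeros directly to its left (`atom_eq_refinementSum`).
This holds since each letter of a reduced word moves one nonzero entry past one zero, and there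
`quasiTheta` replaces `x_i^k` by the sum of all `x_i^a x_{i+1}^b` with `a + b = k` and `b ≥ 1`.

Hence the coefficient of `x^m` in the product counts the pairs of a refinement of `α` and a
refinement of `β` with sum `m`. On the right it is the signed count of atom partitions `S` whose
weight is refined by `m`. Cut each part of such an `S` in weakly decreasing order into pieces of the
sizes prescribed by `m`. The ascents between parts make this reversible, since the parts of `S` are
the maximal weakly decreasing runs of the result. So the sum runs over the fillings `T` of weight
`m` arising in this way, the loose atom partitions, and signs are preserved (`sum_qamp_eq`).

For a value `i` in both supports, a loose atom partition has both circled letters of value `i` in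
position `i`, or exactly one of them is detached to the left and the other is alone in position `i`.
Unlike in `S`, the detached letter may be barred: cutting `S i` can push circled barred `i` away
from the smaller circled `i`. This restores a symmetry between the two colours. If `m i ≤ 1`, one
letter must be detached, and exchanging the colours of the two circled letters is a sign-reversing
involution; the product has coefficient zero as well, because both refinements are positive at `i`.
If `m i ≥ 2` for all common `i`, nothing is detached and all signs are `+1`; such a filling is
determined by its numbers of barred and unbarred letters in each position, that is, by a pair of
refinements (`sum_loose_eq_card`).

The sum is cancellation free because circled `i` has moved in `S` exactly when both entries at `i`
are nonzero and `S i` has size one, so the weight determines the sign (`IsAtomPartition.moved_iff`).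
-/

namespace FundamentalAtom

open MvPolynomial

/-! ### Blocks and refinements -/

/-- `q` is the first position weakly right of `p` where `c` does not vanish. -/
def NextNonzero {n : ℕ} {M : Type*} [Zero M] (c : Fin n → M) (p q : Fin n) : Prop :=
  p ≤ q ∧ c q ≠ 0 ∧ ∀ r, p ≤ r → r < q → c r = 0

section NextNonzero

variable {n : ℕ} {M : Type*} [Zero M] {c : Fin n → M} {p p' q q' : Fin n}

theorem NextNonzero.unique (h : NextNonzero c p q) (h' : NextNonzero c p q') : q = q' := by
  rcases lt_trichotomy q q' with hlt | rfl | hlt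
  · exact absurd (h'.2.2 q h.1 hlt) h.2.1
  · rfl
  · exact absurd (h.2.2 q' h'.1 hlt) h'.2.1

theorem nextNonzero_self (h : c q ≠ 0) : NextNonzero c q q :=
  ⟨le_rfl, h, fun _ h1 h2 => absurd h2 (not_lt.mpr h1)⟩

theorem exists_nextNonzero (hpq : p ≤ q) (h : c q ≠ 0) : ∃ r ≤ q, NextNonzero c p r := by
  obtain ⟨r, ⟨hr, hcr⟩, hmin⟩ := WellFounded.has_min (wellFounded_lt (α := Fin n))
    {r | p ≤ r ∧ c r ≠ 0} ⟨q, hpq, h⟩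
  refine ⟨r, not_lt.mp (hmin q ⟨hpq, h⟩), hr, hcr, fun s hs hsr => ?_⟩
  by_contra hcs
  exact hmin s ⟨hs, hcs⟩ hsr

theorem NextNonzero.mono (h : NextNonzero c p q) (h' : NextNonzero c p' q') (hp : p ≤ p') :
    q ≤ q' := by
  obtain ⟨r, hr, hpr⟩ := exists_nextNonzero (hp.trans h'.1) h'.2.1
  exact h.unique hpr ▸ hr

end NextNonzero

open Classical in
theorem sum_blocks {n : ℕ} {M : Type*} [Zero M] {N : Type*} [AddCommMonoid N] (c : Fin n → M)
    (m : Fin n → N) (s : Finset (Fin n)) :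
    ∑ q ∈ s, ∑ p with NextNonzero c p q, m p = ∑ p with ∃ q ∈ s, NextNonzero c p q, m p := by
  rw [← Finset.sum_biUnion]
  · congr 1
    ext p
    simp
  · intro q _ q' _ hne
    rw [Function.onFun, Finset.disjoint_filter]
    exact fun p _ h h' => hne (h.unique h')

/-- `m` is obtained from `c` by distributing each nonzero entry over its own position, where
something has to stay, and the zero positions directly to its left. -/
def IsRefinement {n : ℕ} (c m : Fin n → ℕ) : Prop :=
  (∀ q, c q ≠ 0 → m q ≠ 0 ∧ ∑ p ∈ Finset.Iic q, m p = ∑ p ∈ Finset.Iic q, c p) ∧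
    ∑ p, m p = ∑ p, c p

open Classical in
theorem sum_blocks_Iic {n : ℕ} {c : Fin n → ℕ} (m : Fin n → ℕ) {q : Fin n} (hq : c q ≠ 0) :
    ∑ r ∈ Finset.Iic q, ∑ p with NextNonzero c p r, m p = ∑ p ∈ Finset.Iic q, m p := by
  rw [sum_blocks]
  congr 1
  ext p
  simp only [Finset.mem_Iic, Finset.mem_filter, Finset.mem_univ, true_and]
  constructor
  · rintro ⟨r, hr, h⟩
    exact h.1.trans hr
  · exact fun hp => exists_nextNonzero hp hq

-- Prefix sums suit the operators, since a simple transposition disturbs only one of them; block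
-- sums suit the distribution of letters. Block sums follow from prefix sums by induction on `q`,
-- and the total then leaves nothing for the positions right of the last nonzero entry.
open Classical in
theorem isRefinement_iff {n : ℕ} {c m : Fin n → ℕ} :
    IsRefinement c m ↔ (∀ q, c q ≠ 0 → m q ≠ 0) ∧
      (∀ q, c q ≠ 0 → ∑ p with NextNonzero c p q, m p = c q) ∧
      ∀ p, (∀ q, ¬ NextNonzero c p q) → m p = 0 := by
  have hzero : ∀ q, c q = 0 → ∑ p with NextNonzero c p q, m p = c q := by
    intro q hq
    rw [hq]
    exact Finset.sum_eq_zero fun p hp => absurd hq (Finset.mem_filter.mp hp).2.2.1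
  have htot := sum_blocks c m Finset.univ
  have hsplit := Finset.sum_filter_add_sum_filter_not Finset.univ
    (fun p => ∃ q ∈ Finset.univ, NextNonzero c p q) m
  constructor
  · rintro ⟨h1, h2⟩
    have hb : ∀ q, c q ≠ 0 → ∑ p with NextNonzero c p q, m p = c q := by
      intro q
      induction q using WellFoundedLT.induction with
      | ind q ih =>
        intro hq
        have e1 := sum_blocks_Iic m hq
        rw [(h1 q hq).2, ← Finset.Iio_insert, Finset.sum_insert (by simp),
          Finset.sum_insert (by simp)] at e1
        have e2 : ∑ r ∈ Finset.Iio q, ∑ p with NextNonzero c p r, m p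
            = ∑ r ∈ Finset.Iio q, c r := by
          refine Finset.sum_congr rfl fun r hr => ?_
          by_cases hcr : c r = 0
          · exact hzero r hcr
          · exact ih r (Finset.mem_Iio.mp hr) hcr
        omega
    refine ⟨fun q hq => (h1 q hq).1, hb, ?_⟩
    have e : ∑ q, ∑ p with NextNonzero c p q, m p = ∑ q, c q :=
      Finset.sum_congr rfl fun q _ => by
        by_cases hq : c q = 0
        exacts [hzero q hq, hb q hq]
    have hz : ∑ p with ¬ ∃ q ∈ Finset.univ, NextNonzero c p q, m p = 0 := by omega
    intro p hp
    exact Finset.sum_eq_zero_iff.mp hz p (by simpa using hp)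
  · rintro ⟨h1, h2, h3⟩
    have hb : ∀ q, ∑ p with NextNonzero c p q, m p = c q := fun q => by
      by_cases hq : c q = 0
      exacts [hzero q hq, h2 q hq]
    refine ⟨fun q hq => ⟨h1 q hq, ?_⟩, ?_⟩
    · rw [← sum_blocks_Iic m hq]
      exact Finset.sum_congr rfl fun r _ => hb r
    · have hz : ∑ p with ¬ ∃ q ∈ Finset.univ, NextNonzero c p q, m p = 0 :=
        Finset.sum_eq_zero fun p hp => h3 p (by simpa using hp)
      rw [← hsplit, hz, ← htot, add_zero]
      exact Finset.sum_congr rfl fun r _ => hb r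

/-! ### Distributing a multiset in weakly decreasing order -/

/-- The decreasing list of `A + B` is that of `A` followed by that of `B`, so `A` is recovered as
its initial segment of known length. -/
theorem eq_of_add_eq_add_of_sorted {L : Type*} [LinearOrder L] {A B A' B' : Multiset L}
    (h : A + B = A' + B') (hAB : ∀ x ∈ A, ∀ y ∈ B, y ≤ x) (hAB' : ∀ x ∈ A', ∀ y ∈ B', y ≤ x)
    (hc : A.card = A'.card) : A = A' ∧ B = B' := by
  have key : ∀ A B : Multiset L, (∀ x ∈ A, ∀ y ∈ B, y ≤ x) →
      (A + B).sort (· ≥ ·) = A.sort (· ≥ ·) ++ B.sort (· ≥ ·) := by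
    intro A B hAB
    refine List.Perm.eq_of_pairwise' (r := (· ≥ ·)) ?_ ?_ ?_
    · exact Multiset.pairwise_sort _ _
    · rw [List.pairwise_append]
      exact ⟨Multiset.pairwise_sort _ _, Multiset.pairwise_sort _ _, fun x hx y hy =>
        hAB x ((Multiset.mem_sort _).mp hx) y ((Multiset.mem_sort _).mp hy)⟩
    · rw [← Multiset.coe_eq_coe, Multiset.sort_eq, ← Multiset.coe_add, Multiset.sort_eq,
        Multiset.sort_eq]
  have e := key A B hAB
  rw [h, key A' B' hAB'] at e
  obtain ⟨e1, e2⟩ := List.append_inj e (by simp [hc])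
  constructor
  · rw [← Multiset.sort_eq A (· ≥ ·), ← e1, Multiset.sort_eq]
  · rw [← Multiset.sort_eq B (· ≥ ·), ← e2, Multiset.sort_eq]

theorem exists_add_eq_of_le_card {L : Type*} [LinearOrder L] (S : Multiset L) {k : ℕ}
    (hk : k ≤ S.card) :
    ∃ A B : Multiset L, A + B = S ∧ A.card = k ∧ ∀ x ∈ A, ∀ y ∈ B, y ≤ x := by
  refine ⟨((S.sort (· ≥ ·)).take k : List L), ((S.sort (· ≥ ·)).drop k : List L), ?_, ?_, ?_⟩
  · rw [Multiset.coe_add, List.take_append_drop, Multiset.sort_eq]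
  · simpa using hk
  · have h := Multiset.pairwise_sort S (· ≥ ·)
    rw [← List.take_append_drop k (S.sort (· ≥ ·)), List.pairwise_append] at h
    exact fun x hx y hy => h.2.2 x (by simpa using hx) y (by simpa using hy)

theorem exists_distribution {L : Type*} [LinearOrder L] {n : ℕ} (S : Multiset L) (m : Fin n → ℕ)
    (h : ∑ p, m p = S.card) :
    ∃ T : Fin n → Multiset L, ∑ p, T p = S ∧ (∀ p, (T p).card = m p) ∧
      ∀ p q, p < q → ∀ x ∈ T p, ∀ y ∈ T q, y ≤ x := by
  induction n generalizing S with
  | zero =>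
    refine ⟨fun _ => 0, ?_, fun p => p.elim0, fun p => p.elim0⟩
    simpa [eq_comm] using h
  | succ n ih =>
    rw [Fin.sum_univ_succ] at h
    obtain ⟨A, B, hS, hA, hAB⟩ := exists_add_eq_of_le_card S (k := m 0) (by omega)
    obtain ⟨T, hT, hm, hs⟩ := ih B (fun p => m p.succ) (by
      rw [← hS, Multiset.card_add] at h
      omega)
    refine ⟨Fin.cons A T, ?_, ?_, ?_⟩
    · simp [Fin.sum_univ_succ, hT, hS]
    · intro p
      cases p using Fin.cases with
      | zero => simpa using hA
      | succ p => simpa using hm p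
    · intro p q hpq x hx y hy
      cases q using Fin.cases with
      | zero => simp at hpq
      | succ q =>
        simp only [Fin.cons_succ] at hy
        cases p using Fin.cases with
        | zero =>
          refine hAB x (by simpa using hx) y ?_
          rw [← hT]
          exact Multiset.mem_sum.mpr ⟨q, Finset.mem_univ _, hy⟩
        | succ p => exact hs p q (by simpa using hpq) x (by simpa using hx) y hy

theorem distribution_unique {L : Type*} [LinearOrder L] {n : ℕ} {T T' : Fin n → Multiset L}
    (h : ∑ p, T p = ∑ p, T' p) (hc : ∀ p, (T p).card = (T' p).card)
    (hT : ∀ p q, p < q → ∀ x ∈ T p, ∀ y ∈ T q, y ≤ x)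
    (hT' : ∀ p q, p < q → ∀ x ∈ T' p, ∀ y ∈ T' q, y ≤ x) : T = T' := by
  induction n with
  | zero => exact Subsingleton.elim _ _
  | succ n ih =>
    rw [Fin.sum_univ_succ, Fin.sum_univ_succ] at h
    have key : ∀ T : Fin (n + 1) → Multiset L,
        (∀ p q, p < q → ∀ x ∈ T p, ∀ y ∈ T q, y ≤ x) →
        ∀ x ∈ T 0, ∀ y ∈ ∑ p : Fin n, T p.succ, y ≤ x := by
      intro T hT x hx y hy
      obtain ⟨p, _, hp⟩ := Multiset.mem_sum.mp hy
      exact hT 0 p.succ (Fin.succ_pos p) x hx y hp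
    obtain ⟨h0, h1⟩ := eq_of_add_eq_add_of_sorted h (key T hT) (key T' hT') (hc 0)
    have := ih h1 (fun p => hc p.succ) (fun p q hpq => hT _ _ (Fin.succ_lt_succ_iff.mpr hpq))
      (fun p q hpq => hT' _ _ (Fin.succ_lt_succ_iff.mpr hpq))
    funext p
    cases p using Fin.cases with
    | zero => exact h0
    | succ p => exact congrFun this p

/-! ### Splitting the parts of a sequence of multisets -/

open Classical in
/-- `T` is obtained from `S` by distributing, in weakly decreasing order, each nonempty part over
its own position, where something has to stay, and the empty positions directly to its left. -/
structure IsSplitting {n : ℕ} {L : Type*} [LinearOrder L] (S T : Fin n → Multiset L) : Prop where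
  ne_zero : ∀ q, S q ≠ 0 → T q ≠ 0
  sum_block : ∀ q, S q ≠ 0 → ∑ p with NextNonzero S p q, T p = S q
  eq_zero : ∀ p, (∀ q, ¬ NextNonzero S p q) → T p = 0
  anti : ∀ p q, p < q → (∀ r, p ≤ r → r < q → S r = 0) → ∀ x ∈ T p, ∀ y ∈ T q, y ≤ x

/-- Between consecutive nonempty parts there is an ascent. -/
def HasAscents {n : ℕ} {L : Type*} [LinearOrder L] (S : Fin n → Multiset L) : Prop :=
  ∀ p q, p < q → S p ≠ 0 → S q ≠ 0 → (∀ r, p < r → r < q → S r = 0) → ∃ x ∈ S p, ∃ y ∈ S q, x < y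

theorem nextNonzero_card {n : ℕ} {L : Type*} (S : Fin n → Multiset L) (p q : Fin n) :
    NextNonzero (fun p => (S p).card) p q ↔ NextNonzero S p q := by
  simp [NextNonzero]

section IsSplitting

variable {n : ℕ} {L : Type*} [LinearOrder L] {S S' T T' : Fin n → Multiset L}

theorem IsSplitting.exists_of_mem_right (h : IsSplitting S T) {p : Fin n} {x : L} (hx : x ∈ T p) :
    ∃ q, NextNonzero S p q ∧ x ∈ S q := by
  by_cases hp : ∃ q, NextNonzero S p q
  · obtain ⟨q, hq⟩ := hp
    refine ⟨q, hq, ?_⟩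
    rw [← h.sum_block q hq.2.1]
    exact Multiset.mem_sum.mpr ⟨p, by simpa using hq, hx⟩
  · rw [h.eq_zero p (not_exists.mp hp)] at hx
    simp at hx

theorem IsSplitting.exists_of_mem_left (h : IsSplitting S T) {q : Fin n} {x : L} (hx : x ∈ S q) :
    ∃ p, NextNonzero S p q ∧ x ∈ T p := by
  have hq : S q ≠ 0 := by rintro h0; simp [h0] at hx
  rw [← h.sum_block q hq] at hx
  obtain ⟨p, hp, hxp⟩ := Multiset.mem_sum.mp hx
  exact ⟨p, by simpa using hp, hxp⟩

theorem IsSplitting.mem_of_nextNonzero (h : IsSplitting S T) {p q : Fin n} {x : L} (hx : x ∈ T p)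
    (hpq : NextNonzero S p q) : x ∈ S q := by
  obtain ⟨r, hr, hxr⟩ := h.exists_of_mem_right hx
  exact hpq.unique hr ▸ hxr

theorem IsSplitting.sum_eq (h : IsSplitting S T) : ∑ p, T p = ∑ p, S p := by
  classical
  have h1 := sum_blocks S T Finset.univ
  have h2 := Finset.sum_filter_add_sum_filter_not Finset.univ
    (fun p => ∃ q ∈ Finset.univ, NextNonzero S p q) T
  rw [← h2, ← h1]
  have hz : ∑ p with ¬ ∃ q ∈ Finset.univ, NextNonzero S p q, T p = 0 :=
    Finset.sum_eq_zero fun p hp => h.eq_zero p (by simpa using hp)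
  rw [hz, add_zero]
  refine Finset.sum_congr rfl fun q _ => ?_
  by_cases hq : S q = 0
  · rw [hq]
    exact Finset.sum_eq_zero fun p hp => absurd hq (Finset.mem_filter.mp hp).2.2.1
  · convert h.sum_block q hq

theorem IsSplitting.isRefinement (h : IsSplitting S T) :
    IsRefinement (fun p => (S p).card) (fun p => (T p).card) := by
  classical
  rw [isRefinement_iff]
  refine ⟨fun q hq => ?_, fun q hq => ?_, fun p hp => ?_⟩
  · have := h.ne_zero q (by simpa using hq)
    simpa using this
  · simp only [nextNonzero_card]
    rw [← Multiset.card_sum]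
    congr 1
    convert h.sum_block q (by simpa using hq)
  · simp only [nextNonzero_card] at hp
    simp [h.eq_zero p hp]

theorem exists_isSplitting (S : Fin n → Multiset L) (m : Fin n → ℕ)
    (h : IsRefinement (fun p => (S p).card) m) :
    ∃ T : Fin n → Multiset L, IsSplitting S T ∧ ∀ p, (T p).card = m p := by
  classical
  rw [isRefinement_iff] at h
  simp only [nextNonzero_card] at h
  obtain ⟨h1, h2, h3⟩ := h
  have key : ∀ q, ∃ U : Fin n → Multiset L, S q ≠ 0 → ∑ p, U p = S q ∧
      (∀ p, (U p).card = if NextNonzero S p q then m p else 0) ∧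
      ∀ p p', p < p' → ∀ x ∈ U p, ∀ y ∈ U p', y ≤ x := by
    intro q
    by_cases hq : S q = 0
    · exact ⟨0, fun h => absurd hq h⟩
    · obtain ⟨U, hU⟩ := exists_distribution (S q) (fun p => if NextNonzero S p q then m p else 0)
        (by rw [← Finset.sum_filter]; convert h2 q (by simpa using hq))
      exact ⟨U, fun _ => hU⟩
  choose U hU using key
  -- A position lies in at most one block, so this sum has at most one term; it is empty to the
  -- right of the last nonempty part.
  set T : Fin n → Multiset L := fun p => ∑ q with NextNonzero S p q, U q p with hTdef
  have hT : ∀ p q, NextNonzero S p q → T p = U q p := by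
    intro p q hpq
    have : Finset.univ.filter (fun q => NextNonzero S p q) = {q} := by
      ext r
      simp only [Finset.mem_filter, Finset.mem_univ, true_and, Finset.mem_singleton]
      exact ⟨fun hr => hr.unique hpq, fun hr => hr ▸ hpq⟩
    simp only [hTdef, this, Finset.sum_singleton]
  have hT0 : ∀ p, (∀ q, ¬ NextNonzero S p q) → T p = 0 := by
    intro p hp
    exact Finset.sum_eq_zero fun q hq => absurd (Finset.mem_filter.mp hq).2 (hp q)
  have hcard : ∀ p, (T p).card = m p := by
    intro p
    by_cases hp : ∃ q, NextNonzero S p q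
    · obtain ⟨q, hq⟩ := hp
      rw [hT p q hq, (hU q hq.2.1).2.1 p, if_pos hq]
    · rw [hT0 p (not_exists.mp hp), h3 p (not_exists.mp hp), Multiset.card_zero]
  refine ⟨T, ⟨fun q hq => ?_, fun q hq => ?_, hT0, fun p p' hpp' hz x hx y hy => ?_⟩, hcard⟩
  · have := h1 q (by simpa using hq)
    rw [← hcard q] at this
    simpa using this
  · rw [← (hU q hq).1, Finset.sum_filter]
    refine Finset.sum_congr rfl fun p _ => ?_
    split_ifs with hp
    · exact hT p q hp
    · have := (hU q hq).2.1 p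
      rw [if_neg hp, Multiset.card_eq_zero] at this
      exact this.symm
  · by_cases hp : ∃ q, NextNonzero S p' q
    · obtain ⟨q, hq⟩ := hp
      have hq' : NextNonzero S p q := by
        refine ⟨hpp'.le.trans hq.1, hq.2.1, fun r h1 h2 => ?_⟩
        rcases lt_or_ge r p' with h | h
        · exact hz r h1 h
        · exact hq.2.2 r h h2
      rw [hT p q hq'] at hx
      rw [hT p' q hq] at hy
      exact (hU q hq.2.1).2.2 p p' hpp' x hx y hy
    · rw [hT0 p' (not_exists.mp hp)] at hy
      simp at hy

/-- Blocks are treated one at a time: with the pieces outside the block replaced by `0`, each is a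
weakly decreasing distribution of one multiset with given sizes. -/
theorem IsSplitting.unique_right (h : IsSplitting S T) (h' : IsSplitting S T')
    (hc : ∀ p, (T p).card = (T' p).card) : T = T' := by
  classical
  funext p
  by_cases hp : ∃ q, NextNonzero S p q
  · obtain ⟨q, hq⟩ := hp
    have anti : ∀ T, IsSplitting S T → ∀ p p', p < p' →
        ∀ x ∈ (if NextNonzero S p q then T p else 0),
        ∀ y ∈ (if NextNonzero S p' q then T p' else 0), y ≤ x := by
      intro T hT p p' hpp' x hx y hy
      split_ifs at hx hy with h1 h2
      · exact hT.anti p p' hpp' (fun r hr hr' => h1.2.2 r hr (hr'.trans_le h2.1)) x hx y hy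
      all_goals simp_all
    have := distribution_unique (T := fun p => if NextNonzero S p q then T p else 0)
      (T' := fun p => if NextNonzero S p q then T' p else 0) ?_ ?_ (anti T h) (anti T' h')
    · simpa [hq] using congrFun this p
    · rw [← Finset.sum_filter, ← Finset.sum_filter]
      have e := h.sum_block q hq.2.1
      have e' := h'.sum_block q hq.2.1
      convert e.trans e'.symm
    · intro p
      split_ifs
      · exact hc p
      · rfl
  · rw [h.eq_zero p (not_exists.mp hp), h'.eq_zero p (not_exists.mp hp)]

/-- The part at `q` is nonempty, and it is the last one or followed by an ascent. -/
def IsRunEnd (T : Fin n → Multiset L) (q : Fin n) : Prop :=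
  T q ≠ 0 ∧ ∀ q', q < q' → T q' ≠ 0 → (∀ r, q < r → r < q' → T r = 0) → ∃ x ∈ T q, ∃ y ∈ T q', x < y

/-- A nonempty part that is not a run end is followed by a nonempty part without ascent. These
comparisons chain through any letter of the intermediate part. -/
theorem anti_of_no_runEnd (T : Fin n → Multiset L) (q : Fin n) :
    ∀ p, p < q → (∀ r, p ≤ r → r < q → ¬ IsRunEnd T r) → ∀ x ∈ T p, ∀ y ∈ T q, y ≤ x := by
  intro p
  induction p using WellFoundedGT.induction with
  | ind p ih =>
    intro hpq hno x hx y hy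
    have hTp : T p ≠ 0 := by rintro h0; simp [h0] at hx
    have hp := hno p le_rfl hpq
    simp only [IsRunEnd, not_and, not_forall] at hp
    obtain ⟨q', hpq', hTq', hz, hna⟩ := hp hTp
    have hdesc : ∀ x ∈ T p, ∀ y ∈ T q', y ≤ x := fun x hx y hy =>
      not_lt.mp fun hlt => hna ⟨x, hx, y, hy, hlt⟩
    rcases lt_trichotomy q' q with hlt | rfl | hlt
    · obtain ⟨z, hzq⟩ := Multiset.exists_mem_of_ne_zero hTq'
      exact (ih q' hpq' hlt (fun r h1 h2 => hno r (hpq'.le.trans h1) h2) z hzq y hy).trans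
        (hdesc x hx z hzq)
    · exact hdesc x hx y hy
    · rw [hz q hpq hlt] at hy
      simp at hy

theorem exists_merging (T : Fin n → Multiset L) :
    ∃ S : Fin n → Multiset L, IsSplitting S T ∧ HasAscents S := by
  classical
  -- The indicator of the run ends: its blocks are the maximal weakly decreasing runs, each
  -- collected at its last position.
  set E : Fin n → ℕ := fun q => if IsRunEnd T q then 1 else 0 with hE
  have hE0 : ∀ q, E q ≠ 0 ↔ IsRunEnd T q := fun q => by simp [hE]
  set S : Fin n → Multiset L := fun q => ∑ p with NextNonzero E p q, T p with hS
  have hS0 : ∀ q, S q ≠ 0 ↔ E q ≠ 0 := by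
    intro q
    constructor
    · intro h hEq
      exact h (Finset.sum_eq_zero fun p hp => absurd hEq (Finset.mem_filter.mp hp).2.2.1)
    · intro h hSq
      obtain ⟨x, hx⟩ := Multiset.exists_mem_of_ne_zero ((hE0 q).mp h).1
      have : x ∈ S q := Multiset.mem_sum.mpr ⟨q, by simpa using nextNonzero_self h, hx⟩
      simp [hSq] at this
  have hnext : ∀ p q, NextNonzero S p q ↔ NextNonzero E p q := by
    intro p q
    have hz : ∀ r, S r = 0 ↔ E r = 0 := fun r => not_iff_not.mp (hS0 r)
    simp only [NextNonzero, ne_eq, hz]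
  have hend : ∀ p, T p ≠ 0 → ∃ q, p ≤ q ∧ IsRunEnd T q := by
    intro p hp
    obtain ⟨q, ⟨hq1, hq2⟩, hmax⟩ := WellFounded.has_min (wellFounded_gt (α := Fin n))
      {q | p ≤ q ∧ T q ≠ 0} ⟨p, le_rfl, hp⟩
    exact ⟨q, hq1, hq2, fun q' hqq' hTq' => absurd hqq' (hmax q' ⟨hq1.trans hqq'.le, hTq'⟩)⟩
  refine ⟨S, ⟨fun q hq => ?_, fun q hq => ?_, fun p hp => ?_, fun p q hpq hz => ?_⟩, ?_⟩
  · exact ((hE0 q).mp ((hS0 q).mp hq)).1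
  · exact Finset.sum_congr (by ext p; simp only [Finset.mem_filter, hnext]) fun _ _ => rfl
  · by_contra hTp
    obtain ⟨q, hpq, hq⟩ := hend p hTp
    obtain ⟨r, -, hr⟩ := exists_nextNonzero hpq ((hE0 q).mpr hq)
    exact hp r ((hnext p r).mpr hr)
  · exact anti_of_no_runEnd T q p hpq fun r h1 h2 h3 =>
      (hS0 r).mpr ((hE0 r).mpr h3) (hz r h1 h2)
  · intro p q hpq hp hq hz
    have hTp := (hE0 p).mp ((hS0 p).mp hp)
    have hTq := (hE0 q).mp ((hS0 q).mp hq)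
    obtain ⟨r, ⟨hr1, hr2⟩, hmin⟩ := WellFounded.has_min (wellFounded_lt (α := Fin n))
      {r | p < r ∧ T r ≠ 0} ⟨q, hpq, hTq.1⟩
    obtain ⟨x, hx, y, hy, hxy⟩ := hTp.2 r hr1 hr2 fun s h1 h2 => by
      by_contra hs
      exact hmin s ⟨h1, hs⟩ h2
    refine ⟨x, ?_, y, ?_, hxy⟩
    · exact Multiset.mem_sum.mpr ⟨p, by simpa using nextNonzero_self ((hS0 p).mp hp), hx⟩
    · refine Multiset.mem_sum.mpr ⟨r, ?_, hy⟩
      simp only [Finset.mem_filter, Finset.mem_univ, true_and, ← hnext]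
      exact ⟨not_lt.mp (hmin q ⟨hpq, hTq.1⟩), hq, fun s h1 h2 => hz s (hr1.trans_le h1) h2⟩

/-- The supports of the merged parts can be read off from the pieces, which makes merging unique. An
ascent between parts survives cutting, because the last piece of a part holds its minimum and the
first nonempty piece of the next part holds its maximum; inside a block no ascent is possible. -/
theorem IsSplitting.ne_zero_iff_isRunEnd (h : IsSplitting S T) (hS : HasAscents S) (q : Fin n) :
    S q ≠ 0 ↔ IsRunEnd T q := by
  constructor
  · intro hq
    refine ⟨h.ne_zero q hq, fun q' hqq' hTq' hz => ?_⟩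
    obtain ⟨z, hzq⟩ := Multiset.exists_mem_of_ne_zero hTq'
    obtain ⟨s, hs, -⟩ := h.exists_of_mem_right hzq
    obtain ⟨x, hx, y, hy, hxy⟩ := hS q s (hqq'.trans_le hs.1) hq hs.2.1 fun r h1 h2 => by
      rcases lt_or_ge r q' with hr | hr
      · by_contra hSr
        exact h.ne_zero r hSr (hz r h1 hr)
      · exact hs.2.2 r hr h2
    -- `x` may have been cut off to the left, but then every letter remaining at `q` is at most `x`.
    have hx' : ∃ x' ∈ T q, x' ≤ x := by
      obtain ⟨p, hp, hxp⟩ := h.exists_of_mem_left hx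
      rcases hp.1.lt_or_eq with hlt | rfl
      · obtain ⟨w, hw⟩ := Multiset.exists_mem_of_ne_zero (h.ne_zero q hq)
        exact ⟨w, hw, h.anti p q hlt hp.2.2 x hxp w hw⟩
      · exact ⟨x, hxp, le_rfl⟩
    -- Dually, `q'` carries the first nonempty piece after `q`, so its letters dominate all later
    -- pieces of the block.
    have hy' : ∃ y' ∈ T q', y ≤ y' := by
      obtain ⟨p, hp, hyp⟩ := h.exists_of_mem_left hy
      have hqp : q < p := by
        by_contra hle
        exact hq (hp.2.2 q (not_lt.mp hle) (hqq'.trans_le hs.1))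
      have hTp : T p ≠ 0 := by rintro h0; simp [h0] at hyp
      rcases lt_trichotomy p q' with hlt | rfl | hlt
      · exact absurd (hz p hqp hlt) hTp
      · exact ⟨y, hyp, le_rfl⟩
      · exact ⟨z, hzq, h.anti q' p hlt (fun r h1 h2 => hs.2.2 r h1 (h2.trans_le hp.1)) z hzq y hyp⟩
    obtain ⟨x', hx'T, hx'⟩ := hx'
    obtain ⟨y', hy'T, hy'⟩ := hy'
    exact ⟨x', hx'T, y', hy'T, hx'.trans_lt (hxy.trans_le hy')⟩
  · rintro ⟨hTq, hasc⟩ hSq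
    obtain ⟨z, hzq⟩ := Multiset.exists_mem_of_ne_zero hTq
    obtain ⟨s, hs, -⟩ := h.exists_of_mem_right hzq
    have hqs : q < s := lt_of_le_of_ne hs.1 (by rintro rfl; exact hs.2.1 hSq)
    obtain ⟨r, ⟨hr1, hr2⟩, hmin⟩ := WellFounded.has_min (wellFounded_lt (α := Fin n))
      {r | q < r ∧ T r ≠ 0} ⟨s, hqs, h.ne_zero s hs.2.1⟩
    obtain ⟨x, hx, y, hy, hxy⟩ := hasc r hr1 hr2 fun t h1 h2 => by
      by_contra ht
      exact hmin t ⟨h1, ht⟩ h2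
    refine absurd (h.anti q r hr1 (fun t h1 h2 => hs.2.2 t h1 (h2.trans_le ?_)) x hx y hy)
      (not_le.mpr hxy)
    exact not_lt.mp (hmin s ⟨hqs, h.ne_zero s hs.2.1⟩)

theorem IsSplitting.unique_left (h : IsSplitting S T) (h' : IsSplitting S' T)
    (hS : HasAscents S) (hS' : HasAscents S') : S = S' := by
  classical
  have hz : ∀ r, S r = 0 ↔ S' r = 0 := fun r => not_iff_not.mp
    ((h.ne_zero_iff_isRunEnd hS r).trans (h'.ne_zero_iff_isRunEnd hS' r).symm)
  funext q
  by_cases hq : S q = 0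
  · rw [hq, (hz q).mp hq]
  · rw [← h.sum_block q hq, ← h'.sum_block q (fun h0 => hq ((hz q).mpr h0))]
    have hnext : ∀ p, NextNonzero S p q ↔ NextNonzero S' p q := fun p => by
      simp only [NextNonzero, ne_eq, hz]
    exact Finset.sum_congr (by ext p; simp only [Finset.mem_filter, hnext]) fun _ _ => rfl

end IsSplitting

/-! ### Letters, their multiplicities and their positions -/

theorem Letter.value_le_of_le {n : ℕ} {x y : Letter n} (h : x ≤ y) : x.value ≤ y.value := by
  have h' : x.rank ≤ y.rank := h
  simp only [Letter.rank] at h'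
  rw [Fin.le_def]
  split_ifs at h' <;> omega

theorem circ_le {n : ℕ} {x : Letter n} {i : Fin n} (h : i ≤ x.value) : circ i ≤ x := by
  change (circ i).rank ≤ x.rank
  rw [Fin.le_def] at h
  simp only [Letter.rank, circ]
  split_ifs <;> simp_all <;> omega

theorem circ_lt_circBar {n : ℕ} (i : Fin n) : circ i < circBar i := by
  change (circ i).rank < (circBar i).rank
  simp [Letter.rank, circ, circBar]

/-- Among the letters of one value the circled ones are the smallest. -/
theorem circled_of_le {n : ℕ} {x y : Letter n} (h : x ≤ y) (hy : y.circled = true)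
    (hv : y.value ≤ x.value) : x.circled = true := by
  have h' : x.rank ≤ y.rank := h
  by_contra hc
  rw [Fin.le_def] at hv
  simp only [Letter.rank, hy, hc] at h'
  split_ifs at h' <;> simp_all <;> omega

/-- The composition that governs the barred (unbarred) letters. -/
def side {n : ℕ} (α β : Fin n → ℕ) : Bool → Fin n → ℕ
  | true => α
  | false => β

theorem leftBound_le_iff {n : ℕ} {γ : Fin n → ℕ} {i : Fin n} {p : ℕ} :
    leftBound γ i ≤ p ↔ ∀ r, r < i → γ r ≠ 0 → r.val < p := by
  simp only [leftBound, Finset.sup_le_iff, Finset.mem_filter, Finset.mem_univ, true_and, and_imp,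
    Nat.add_one_le_iff]

theorem leftBound_le_self {n : ℕ} (γ : Fin n → ℕ) (i : Fin n) : leftBound γ i ≤ i.val :=
  leftBound_le_iff.mpr fun _ h _ => h

theorem count_content {n : ℕ} (α β : Fin n → ℕ) (v : Fin n) (f c : Bool) :
    (content α β).count ⟨v, f, c⟩ = if c then (if side α β f v ≠ 0 then 1 else 0)
      else side α β f v - 1 := by
  have key : ∀ (γ : Fin n → ℕ) (g : Bool),
      (∑ i, if γ i ≠ 0 then Multiset.replicate (γ i - 1) (⟨i, g, false⟩ : Letter n) +
        {⟨i, g, true⟩} else 0).count ⟨v, f, c⟩ = if f = g then (if c then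
          (if γ v ≠ 0 then 1 else 0) else γ v - 1) else 0 := by
    intro γ g
    rw [Multiset.count_sum', Finset.sum_eq_single v]
    · by_cases hv : γ v = 0 <;> cases f <;> cases g <;> cases c <;>
        simp [hv, Multiset.count_replicate]
    · intro i _ hi
      by_cases hγ : γ i = 0 <;>
        simp [hγ, Multiset.count_replicate, hi, hi.symm]
    · simp
  have h1 := key α true
  have h2 := key β false
  rw [content, Multiset.count_add]
  simp only [bar, circBar, plain, circ]
  rw [h1, h2]
  cases f <;> simp only [side, reduceCtorEq, if_true, if_false, zero_add, add_zero] <;> rfl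

/-- `T` partitions `content α β`, and each letter is in a position allowed for it. -/
structure IsFilling {n : ℕ} (α β : Fin n → ℕ) (T : Fin n → Multiset (Letter n)) : Prop where
  partition : ∑ p, T p = content α β
  range : ∀ p, ∀ x ∈ T p, leftBound (side α β x.barred) x.value ≤ p.val ∧ p ≤ x.value

section IsFilling

variable {n : ℕ} {α β : Fin n → ℕ} {S T : Fin n → Multiset (Letter n)}

theorem IsFilling.side_ne_zero (h : IsFilling α β T) {p : Fin n} {x : Letter n} (hx : x ∈ T p) :
    side α β x.barred x.value ≠ 0 := by
  have hx' : x ∈ content α β := by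
    rw [← h.partition]
    exact Multiset.mem_sum.mpr ⟨p, Finset.mem_univ _, hx⟩
  have hc := Multiset.count_pos.mpr hx'
  obtain ⟨v, f, c⟩ := x
  rw [count_content] at hc
  intro h0
  simp only at h0
  simp [h0] at hc

theorem IsFilling.exists_mem (h : IsFilling α β T) {i : Fin n} {f : Bool}
    (hi : side α β f i ≠ 0) : ∃ p, (⟨i, f, true⟩ : Letter n) ∈ T p := by
  have hx : (⟨i, f, true⟩ : Letter n) ∈ content α β := by
    rw [← Multiset.count_pos, count_content]
    simp [hi]
  rw [← h.partition] at hx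
  obtain ⟨p, -, hp⟩ := Multiset.mem_sum.mp hx
  exact ⟨p, hp⟩

theorem IsFilling.count_circled_le (h : IsFilling α β T) (i : Fin n) (f : Bool) :
    ∑ p, (T p).count ⟨i, f, true⟩ ≤ 1 := by
  rw [← Multiset.count_sum', h.partition, count_content]
  split_ifs <;> simp_all

theorem IsFilling.pos_unique (h : IsFilling α β T) {i p q : Fin n} {f : Bool}
    (hp : (⟨i, f, true⟩ : Letter n) ∈ T p) (hq : (⟨i, f, true⟩ : Letter n) ∈ T q) : p = q := by
  by_contra hne
  have h1 := h.count_circled_le i f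
  have h2 : ∑ r ∈ {p, q}, (T r).count (⟨i, f, true⟩ : Letter n) ≤
      ∑ r, (T r).count (⟨i, f, true⟩ : Letter n) :=
    Finset.sum_le_sum_of_subset (Finset.subset_univ _)
  rw [Finset.sum_pair hne] at h2
  have h3 := Multiset.count_pos.mpr hp
  have h4 := Multiset.count_pos.mpr hq
  omega

theorem IsFilling.lt_of_lt (h : IsFilling α β T) {p r : Fin n} {x : Letter n} (hx : x ∈ T p)
    (hr : side α β x.barred r ≠ 0) (hrx : r < x.value) : r < p :=
  leftBound_le_iff.mp (h.range p x hx).1 r hrx hr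

/-- Letters of smaller value cannot get this far right: their values lie left of both left bounds.
Letters of larger value cannot get this far left: both compositions are nonzero at `i` and block
them. -/
theorem IsFilling.value_eq (h : IsFilling α β T) {i j p : Fin n} (hα : α i ≠ 0) (hβ : β i ≠ 0)
    (hjα : leftBound α i ≤ j) (hjβ : leftBound β i ≤ j) (hjp : j ≤ p) (hpi : p ≤ i)
    {x : Letter n} (hx : x ∈ T p) : x.value = i := by
  have hs : ∀ f, side α β f i ≠ 0 := fun f => by cases f <;> assumption
  have hj : ∀ f, leftBound (side α β f) i ≤ j := fun f => by cases f <;> assumption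
  rcases lt_trichotomy x.value i with hlt | heq | hlt
  · have h1 := leftBound_le_iff.mp (hj x.barred) _ hlt (h.side_ne_zero hx)
    have h2 := (h.range p x hx).2
    exact absurd (hjp.trans h2) (not_le.mpr h1)
  · exact heq
  · exact absurd (h.lt_of_lt hx (hs _) hlt) (not_lt.mpr hpi)

theorem IsAtomPartition.isFilling (h : IsAtomPartition α β S) : IsFilling α β S :=
  ⟨h.partition, fun p x hx => by
    cases hb : x.barred
    · exact h.unbarred_range p x hx hb
    · exact h.barred_range p x hx hb⟩

theorem IsAtomPartition.ne_zero (h : IsAtomPartition α β S) {f : Bool} {r : Fin n}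
    (hr : side α β f r ≠ 0) : S r ≠ 0 := by
  intro h0
  by_cases hα : α r = 0
  · have hβ : β r ≠ 0 := by
      cases f
      · exact hr
      · exact absurd hα hr
    simpa [h0] using h.circ_mem r hα hβ
  · simpa [h0] using h.circBar_mem r hα

theorem IsAtomPartition.hasAscents (h : IsAtomPartition α β S) : HasAscents S := by
  intro p q hpq hp hq hz
  obtain ⟨x, hx, y, hy, -, -, hxy⟩ := h.ascent p q hpq hp hq hz
  exact ⟨x, hx, y, hy, hxy⟩

/-! ### Loose atom partitions -/

/-- One of the two circled letters of value `i` is in position `i`, the other one is further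
left, and no uncircled letter of value `i` is to the right of the latter. The flag `f` tells
whether the letter that is further left is the barred one. -/
def IsDetached (α β : Fin n → ℕ) (T : Fin n → Multiset (Letter n)) (i : Fin n) (f : Bool) : Prop :=
  ∃ j, j < i ∧ leftBound α i ≤ j.val ∧ leftBound β i ≤ j.val ∧ (⟨i, f, true⟩ : Letter n) ∈ T j ∧
    (⟨i, !f, true⟩ : Letter n) ∈ T i ∧ ∀ k, ∀ x ∈ T k, x.value = i → x.circled = false → k ≤ j

/-- The fillings that arise by splitting atom partitions. -/
structure IsLooseAtomPartition (α β : Fin n → ℕ) (T : Fin n → Multiset (Letter n)) : Prop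
    extends IsFilling α β T where
  single : ∀ i f, side α β f i ≠ 0 → side α β (!f) i = 0 → (⟨i, f, true⟩ : Letter n) ∈ T i
  double : ∀ i, α i ≠ 0 → β i ≠ 0 → (circBar i ∈ T i ∧ circ i ∈ T i) ∨ ∃ f, IsDetached α β T i f

/-- Only letters of value `i` could occur between `j` and `i`; the two circled ones sit at the ends,
and the uncircled ones are not right of `j`. -/
theorem IsDetached.eq_zero {i j : Fin n} {f : Bool} (h : IsFilling α β T) (hα : α i ≠ 0)
    (hβ : β i ≠ 0) (hd : IsDetached α β T i f) (hj : (⟨i, f, true⟩ : Letter n) ∈ T j)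
    {r : Fin n} (hjr : j < r) (hri : r < i) : T r = 0 := by
  obtain ⟨j', -, h1, h2, h3, h4, h5⟩ := hd
  obtain rfl := h.pos_unique hj h3
  refine Multiset.eq_zero_of_forall_notMem fun x hx => ?_
  have hv := h.value_eq hα hβ h1 h2 hjr.le hri.le hx
  obtain ⟨v, b, c⟩ := x
  subst hv
  cases c
  · exact absurd (h5 r _ hx rfl rfl) (not_le.mpr hjr)
  · by_cases hbf : b = f
    · subst hbf
      exact hjr.ne (h.pos_unique h3 hx)
    · obtain rfl : b = !f := by cases b <;> cases f <;> simp_all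
      exact hri.ne (h.pos_unique hx h4)

theorem IsDetached.eq_circled {i : Fin n} {f : Bool} (h : IsFilling α β T) (hα : α i ≠ 0)
    (hβ : β i ≠ 0) (hd : IsDetached α β T i f) {x : Letter n} (hx : x ∈ T i) :
    x = ⟨i, !f, true⟩ := by
  obtain ⟨j, hji, h1, h2, h3, h4, h5⟩ := hd
  have hv := h.value_eq hα hβ h1 h2 hji.le le_rfl hx
  obtain ⟨v, b, c⟩ := x
  subst hv
  cases c
  · exact absurd (h5 _ _ hx rfl rfl) (not_le.mpr hji)
  · by_cases hbf : b = f
    · subst hbf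
      exact absurd (h.pos_unique h3 hx) hji.ne
    · obtain rfl : b = !f := by cases b <;> cases f <;> simp_all
      rfl

theorem IsSplitting.mem_left_of_circled {i : Fin n} {f : Bool} (hST : IsSplitting S T)
    (hS : IsFilling α β S) (h : (⟨i, f, true⟩ : Letter n) ∈ T i) :
    (⟨i, f, true⟩ : Letter n) ∈ S i := by
  obtain ⟨q, hq, hm⟩ := hST.exists_of_mem_right h
  have : q ≤ i := (hS.range q _ hm).2
  rwa [le_antisymm this hq.1] at hm

/-! ### Merging loose atom partitions and splitting atom partitions -/

theorem IsSplitting.isFilling_left (hST : IsSplitting S T) (hT : IsFilling α β T) :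
    IsFilling α β S := by
  refine ⟨hST.sum_eq ▸ hT.partition, fun q x hx => ?_⟩
  obtain ⟨p, hp, hxp⟩ := hST.exists_of_mem_left hx
  refine ⟨(hT.range p x hxp).1.trans hp.1, ?_⟩
  -- Merging moves `x` right to `q`. This does not exceed its value: some `y` stayed at `q`, and `y
  -- ≤ x` with `q ≤ y.value`.
  rcases hp.1.lt_or_eq with hlt | rfl
  · obtain ⟨y, hy⟩ := Multiset.exists_mem_of_ne_zero (hST.ne_zero q hp.2.1)
    exact (hT.range q y hy).2.trans
      (Letter.value_le_of_le (hST.anti p q hlt hp.2.2 x hxp y hy))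
  · exact (hT.range p x hxp).2

/-- Any ascent between two parts can be enlarged to one from the minimum of the first to the maximum
of the second, as the definition of an atom partition demands. -/
theorem HasAscents.exists_min_max {L : Type*} [LinearOrder L] {S : Fin n → Multiset L}
    (h : HasAscents S) : ∀ p q, p < q → S p ≠ 0 → S q ≠ 0 → (∀ r, p < r → r < q → S r = 0) →
    ∃ x ∈ S p, ∃ y ∈ S q, (∀ z ∈ S p, x ≤ z) ∧ (∀ z ∈ S q, z ≤ y) ∧ x < y := by
  intro p q hpq hp hq hz
  obtain ⟨x, hx, y, hy, hxy⟩ := h p q hpq hp hq hz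
  obtain ⟨a, ha, hmin⟩ := Finset.exists_min_image (S p).toFinset id ⟨x, by simpa using hx⟩
  obtain ⟨b, hb, hmax⟩ := Finset.exists_max_image (S q).toFinset id ⟨y, by simpa using hy⟩
  simp only [Multiset.mem_toFinset, id] at ha hb hmin hmax
  exact ⟨a, ha, b, hb, hmin, hmax, (hmin x hx).trans_lt (hxy.trans_le (hmax y hy))⟩

/-- A detached barred letter is merged back into position `i`. Otherwise `S` would have an ascent
from the part at `j` to the part at `i`, but the latter is only circled `i`, and no letter of the
part at `j` is smaller. -/
theorem IsSplitting.circBar_mem_of_isDetached {i : Fin n} (hST : IsSplitting S T)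
    (hasc : HasAscents S) (hT : IsFilling α β T) (hα : α i ≠ 0) (hβ : β i ≠ 0)
    (hd : IsDetached α β T i true) : circBar i ∈ S i := by
  have hS := hST.isFilling_left hT
  obtain ⟨j, hji, h1, h2, h3, h4, -⟩ := id hd
  have hb : ∀ r, j < r → r < i → T r = 0 := fun r => hd.eq_zero hT hα hβ h3
  obtain ⟨s, hs, hms⟩ := hST.exists_of_mem_right h3
  have hsi : s ≤ i := (hS.range s _ hms).2
  rcases hsi.lt_or_eq with hlt | rfl
  · exfalso
    have hsj : s = j := by
      rcases hs.1.lt_or_eq with h | h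
      · exact absurd (hb s h hlt) (hST.ne_zero s hs.2.1)
      · exact h.symm
    subst hsj
    have hSi : S i ≠ 0 := by
      intro h0
      have := hST.mem_left_of_circled hS h4
      simp [h0] at this
    obtain ⟨x, hx, y, hy, hxy⟩ := hasc s i hji hs.2.1 hSi fun r hr hr' => by
      by_contra hne
      exact hST.ne_zero r hne (hb r hr hr')
    obtain ⟨p, hp, hyp⟩ := hST.exists_of_mem_left hy
    have hsp : s < p := by
      by_contra hle
      exact hs.2.1 (hp.2.2 s (not_lt.mp hle) hji)
    have hpi : p = i := by
      rcases hp.1.lt_or_eq with h | h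
      · rw [hb p hsp h] at hyp
        simp at hyp
      · exact h
    subst hpi
    rw [hd.eq_circled hT hα hβ hyp] at hxy
    obtain ⟨p', hp', hxp⟩ := hST.exists_of_mem_left hx
    refine absurd hxy (not_lt.mpr ?_)
    rcases hp'.1.lt_or_eq with h | rfl
    · exact (circ_lt_circBar p).le.trans (hST.anti p' s h hp'.2.2 x hxp _ h3)
    · exact circ_le (hT.value_eq hα hβ h1 h2 le_rfl hji.le hxp).ge
  · exact hms

theorem IsSplitting.isAtomPartition (hST : IsSplitting S T) (hasc : HasAscents S)
    (hT : IsLooseAtomPartition α β T) : IsAtomPartition α β S := by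
  have hS := hST.isFilling_left hT.toIsFilling
  refine ⟨hS.partition, fun p x hx hb => ?_, fun p x hx hb => ?_, fun i hα => ?_, fun i hα hβ => ?_,
    fun i j hα hβ hji hj => ?_, hasc.exists_min_max⟩
  · simpa [hb, side] using hS.range p x hx
  · simpa [hb, side] using hS.range p x hx
  · by_cases hβ : β i = 0
    · exact hST.mem_left_of_circled hS (hT.single i true hα hβ)
    · rcases hT.double i hα hβ with ⟨h, -⟩ | ⟨f, hf⟩
      · exact hST.mem_left_of_circled hS h
      · cases f
        · obtain ⟨j, -, -, -, -, h, -⟩ := hf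
          exact hST.mem_left_of_circled hS h
        · exact hST.circBar_mem_of_isDetached hasc hT.toIsFilling hα hβ hf
  · exact hST.mem_left_of_circled hS (hT.single i false hβ hα)
  · have hTi : circ i ∉ T i := fun h =>
      hji.ne (hS.pos_unique hj (hST.mem_left_of_circled hS h))
    rcases hT.double i hα hβ with ⟨-, h⟩ | ⟨f, hf⟩
    · exact absurd h hTi
    · cases f
      · obtain ⟨j', -, h1, h2, h3, -, h5⟩ := hf
        obtain ⟨p, hp, hjp⟩ := hST.exists_of_mem_left hj
        obtain rfl := hT.pos_unique hjp h3
        refine ⟨h1.trans hp.1, fun k x hx hv hc hcb => ?_⟩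
        obtain ⟨p', hp', hxp⟩ := hST.exists_of_mem_left hx
        refine hp'.mono hp (h5 p' x hxp hv ?_)
        obtain ⟨v, b, c⟩ := x
        subst hv
        cases b <;> cases c <;> simp_all [circ, circBar]
      · obtain ⟨j', -, -, -, -, h, -⟩ := hf
        exact absurd h hTi

/-- `S` is nonempty wherever `α` or `β` is nonzero, so no block reaches to the left across a nonzero
entry of either composition. -/
theorem IsAtomPartition.leftBound_le (hS : IsAtomPartition α β S) {p q i : Fin n} {f : Bool}
    (hpq : NextNonzero S p q) (h : leftBound (side α β f) i ≤ q.val) :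
    leftBound (side α β f) i ≤ p.val := by
  rw [leftBound_le_iff] at h ⊢
  intro r hri hr
  by_contra hle
  exact hS.ne_zero hr (hpq.2.2 r (not_lt.mp hle) (h r hri hr))

/-- The last piece of a part is nonempty and contains its smallest letter. -/
theorem IsSplitting.mem_right_of_forall {q : Fin n} {y : Letter n} (hST : IsSplitting S T)
    (hy : y ∈ S q) (h : ∀ x ∈ S q, x ≤ y → x = y) : y ∈ T q := by
  obtain ⟨p, hp, hyp⟩ := hST.exists_of_mem_left hy
  rcases hp.1.lt_or_eq with hlt | rfl
  · obtain ⟨x, hx⟩ := Multiset.exists_mem_of_ne_zero (hST.ne_zero q hp.2.1)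
    rw [← h x (hST.mem_of_nextNonzero hx (nextNonzero_self hp.2.1))
      (hST.anti p q hlt hp.2.2 y hyp x hx)]
    exact hx
  · exact hyp

theorem eq_circ_of_le {x : Letter n} {i : Fin n} (h : x ≤ circ i) (hi : i ≤ x.value) :
    x = circ i :=
  le_antisymm h (circ_le hi)

theorem eq_circ_or_circBar {x : Letter n} {i : Fin n} (h : x ≤ circBar i) (hi : i ≤ x.value) :
    x = circ i ∨ x = circBar i := by
  have hv := le_antisymm (Letter.value_le_of_le h) hi
  have hc := circled_of_le h rfl hi
  obtain ⟨v, b, c⟩ := x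
  simp only [circBar] at hv hc
  subst hv hc
  cases b <;> simp [circ, circBar]

/-- Circled letters are minimal in their parts, so cutting leaves them in place. The one exception
is circled barred `i` in the same part as circled `i`, which may be pushed left and becomes
detached. -/
theorem IsSplitting.isLooseAtomPartition (hST : IsSplitting S T)
    (hS : IsAtomPartition α β S) : IsLooseAtomPartition α β T := by
  have hSF := hS.isFilling
  have hT : IsFilling α β T := by
    refine ⟨hST.sum_eq.trans hS.partition, fun p x hx => ?_⟩
    obtain ⟨q, hq, hxq⟩ := hST.exists_of_mem_right hx
    exact ⟨hS.leftBound_le hq (hSF.range q x hxq).1, hq.1.trans (hSF.range q x hxq).2⟩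
  refine ⟨hT, fun i f h1 h2 => ?_, fun i hα hβ => ?_⟩
  · cases f
    · exact hST.mem_right_of_forall (hS.circ_mem i h2 h1) fun x hx hle =>
        eq_circ_of_le hle (hSF.range i x hx).2
    · refine hST.mem_right_of_forall (hS.circBar_mem i h1) fun x hx hle => ?_
      rcases eq_circ_or_circBar hle (hSF.range i x hx).2 with rfl | h
      · exact absurd h2 (hSF.side_ne_zero hx)
      · exact h
  · have hbar := hS.circBar_mem i hα
    obtain ⟨p, hp⟩ := hSF.exists_mem (i := i) (f := false) hβ
    have hpi : p ≤ i := (hSF.range p _ hp).2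
    rcases hpi.lt_or_eq with hlt | rfl
    · obtain ⟨h1, h2⟩ := hS.circ_moved i p hα hβ hlt hp
      have h3 : leftBound β i ≤ p.val := (hSF.range p _ hp).1
      have hunc : ∀ k, ∀ x ∈ S k, x.value = i → x.circled = false → k ≤ p := by
        intro k x hx hv hc
        refine h2 k x hx hv ?_ ?_ <;> rintro rfl <;> simp [circ, circBar] at hc
      refine Or.inr ⟨false, p, hlt, h1, h3, ?_, ?_, fun k x hx hv hc => ?_⟩
      · exact hST.mem_right_of_forall hp fun x hx hle =>
          eq_circ_of_le hle (hSF.value_eq hα hβ h1 h3 le_rfl hlt.le hx).ge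
      · refine hST.mem_right_of_forall hbar fun x hx hle => ?_
        rcases eq_circ_or_circBar hle (hSF.range i x hx).2 with rfl | h
        · exact absurd (hSF.pos_unique hp hx) hlt.ne
        · exact h
      · obtain ⟨q, hq, hxq⟩ := hST.exists_of_mem_right hx
        exact hq.1.trans (hunc q x hxq hv hc)
    · have hcirc : circ p ∈ T p := hST.mem_right_of_forall hp fun x hx hle =>
        eq_circ_of_le hle (hSF.range p x hx).2
      obtain ⟨j, hj, hjT⟩ := hST.exists_of_mem_left hbar
      rcases hj.1.lt_or_eq with hlt | rfl
      · refine Or.inr ⟨true, j, hlt, ?_, ?_, hjT, hcirc, fun k x hx hv hc => ?_⟩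
        · exact hS.leftBound_le (f := true) hj (leftBound_le_self _ _)
        · exact hS.leftBound_le (f := false) hj (leftBound_le_self _ _)
        -- An uncircled letter of value `i` in a later piece would be at most circled barred `i`,
        -- hence circled.
        · by_contra hjk
          rw [not_le] at hjk
          have hkp : k ≤ p := hv ▸ (hT.range k x hx).2
          have := circled_of_le (hST.anti j k hjk
            (fun r h1 h2 => hj.2.2 r h1 (h2.trans_le hkp)) _ hjT x hx) rfl hv.ge
          simp [hc] at this
      · exact Or.inl ⟨hjT, hcirc⟩

theorem IsSplitting.sgn_eq (hST : IsSplitting S T) (hS : IsAtomPartition α β S) :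
    sgn S = sgn T := by
  have hT := hST.isLooseAtomPartition hS
  have hSF := hS.isFilling
  rw [sgn, sgn]
  congr 1
  ext i
  constructor
  · rintro ⟨p, q, hpq, hp, hq⟩
    have hα : α i ≠ 0 := hSF.side_ne_zero hq
    have hβ : β i ≠ 0 := hSF.side_ne_zero hp
    obtain rfl := hSF.pos_unique hq (hS.circBar_mem i hα)
    obtain ⟨p', hp', hpT⟩ := hST.exists_of_mem_left hp
    have hlt := hp'.1.trans_lt hpq
    rcases hT.double q hα hβ with ⟨-, h⟩ | ⟨f, j, hj, -, -, h1, h2, -⟩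
    · exact absurd (hT.pos_unique hpT h) hlt.ne
    · cases f
      · exact ⟨j, q, hj, h1, h2⟩
      · exact absurd (hT.pos_unique hpT h2) hlt.ne
  · rintro ⟨p, q, hpq, hp, hq⟩
    have hα : α i ≠ 0 := hT.side_ne_zero hq
    have hβ : β i ≠ 0 := hT.side_ne_zero hp
    rcases hT.double i hα hβ with ⟨h, h'⟩ | ⟨f, j, hj, -, -, h1, h2, -⟩
    · exact absurd ((hT.pos_unique hp h').trans (hT.pos_unique h hq)) hpq.ne
    · cases f
      · obtain ⟨s, hs, hsS⟩ := hST.exists_of_mem_right h1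
        have hsi : s ≤ i := (hSF.range s _ hsS).2
        refine ⟨s, i, lt_of_le_of_ne hsi ?_, hsS, hS.circBar_mem i hα⟩
        rintro rfl
        -- Had both circled letters been in one part of `S`, cutting it in decreasing order could
        -- not place the smaller circled `i` further left.
        exact absurd (hST.anti j s hj hs.2.2 _ h1 _ h2) (not_le.mpr (circ_lt_circBar s))
      · have e1 := hT.pos_unique hp h2
        have e2 := hT.pos_unique hq h1
        subst e1 e2
        exact absurd hpq hj.not_gt

/-! ### The sign is determined by the weight -/

/-- If circled `i` has moved, no uncircled letter of value `i` and no letter of another value is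
left in `S i`. If it has not, both circled letters are there. -/
theorem IsAtomPartition.moved_iff (hS : IsAtomPartition α β S) (i : Fin n) :
    (∃ p q, p < q ∧ circ i ∈ S p ∧ circBar i ∈ S q) ↔ α i ≠ 0 ∧ β i ≠ 0 ∧ wt S i = 1 := by
  have hSF := hS.isFilling
  constructor
  · rintro ⟨p, q, hpq, hp, hq⟩
    have hα : α i ≠ 0 := hSF.side_ne_zero hq
    have hβ : β i ≠ 0 := hSF.side_ne_zero hp
    obtain rfl := hSF.pos_unique hq (hS.circBar_mem i hα)
    refine ⟨hα, hβ, ?_⟩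
    obtain ⟨h1, h2⟩ := hS.circ_moved q p hα hβ hpq hp
    have hall : ∀ x ∈ S q, x = circBar q := by
      intro x hx
      by_contra hne
      have hv := hSF.value_eq hα hβ h1 (hSF.range p _ hp).1 hpq.le le_rfl hx
      refine absurd (h2 q x hx hv ?_ hne) (not_le.mpr hpq)
      rintro rfl
      exact hpq.ne (hSF.pos_unique hp hx)
    have hcount : (S q).count (circBar q) ≤ 1 :=
      (Finset.single_le_sum (f := fun r => (S r).count (circBar q)) (fun _ _ => Nat.zero_le _)
        (Finset.mem_univ q)).trans (hSF.count_circled_le q true)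
    have := Multiset.count_pos.mpr hq
    rw [wt, ← Multiset.count_eq_card.mpr fun x hx => (hall x hx).symm]
    omega
  · rintro ⟨hα, hβ, hw⟩
    obtain ⟨p, hp⟩ := hSF.exists_mem (i := i) (f := false) hβ
    have hpi : p ≤ i := (hSF.range p _ hp).2
    have hb := hS.circBar_mem i hα
    refine ⟨p, i, lt_of_le_of_ne hpi ?_, hp, hb⟩
    rintro rfl
    obtain ⟨a, ha⟩ := Multiset.card_eq_one.mp hw
    rw [ha, Multiset.mem_singleton] at hp hb
    exact (circ_lt_circBar p).ne (hp.trans hb.symm)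

theorem sgn_eq_of_wt_eq (hS : IsAtomPartition α β S) (hT : IsAtomPartition α β T)
    (h : wt S = wt T) : sgn S = sgn T := by
  simp only [sgn, hS.moved_iff, hT.moved_iff, h]

end IsFilling

/-! ### Exchanging the two circled letters of one value -/

/-- Exchange circled `i` and circled barred `i` everywhere. -/
noncomputable def swapCircled {n : ℕ} (i : Fin n) (T : Fin n → Multiset (Letter n)) :
    Fin n → Multiset (Letter n) :=
  fun p => (T p).map (Equiv.swap (circ i) (circBar i))

section swapCircled

variable {n : ℕ} {α β : Fin n → ℕ} {T : Fin n → Multiset (Letter n)} {i : Fin n}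

theorem mem_swapCircled {p : Fin n} {x : Letter n} :
    x ∈ swapCircled i T p ↔ Equiv.swap (circ i) (circBar i) x ∈ T p := by
  rw [swapCircled, Multiset.mem_map]
  constructor
  · rintro ⟨y, hy, rfl⟩
    rwa [Equiv.swap_apply_self]
  · exact fun h => ⟨_, h, Equiv.swap_apply_self _ _ _⟩

theorem circled_mem_swapCircled {p : Fin n} {f : Bool} :
    (⟨i, f, true⟩ : Letter n) ∈ swapCircled i T p ↔ (⟨i, !f, true⟩ : Letter n) ∈ T p := by
  rw [mem_swapCircled]
  cases f
  · rw [show (⟨i, false, true⟩ : Letter n) = circ i from rfl, Equiv.swap_apply_left]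
    rfl
  · rw [show (⟨i, true, true⟩ : Letter n) = circBar i from rfl, Equiv.swap_apply_right]
    rfl

theorem mem_swapCircled_of_ne {p : Fin n} {x : Letter n}
    (hx : x.value ≠ i ∨ x.circled = false) : x ∈ swapCircled i T p ↔ x ∈ T p := by
  rw [mem_swapCircled, Equiv.swap_apply_of_ne_of_ne]
  all_goals
    rintro rfl
    simp [circ, circBar] at hx

theorem swapCircled_swapCircled : swapCircled i (swapCircled i T) = T := by
  funext p
  simp [swapCircled, Multiset.map_map]

theorem content_map_swap (hα : α i ≠ 0) (hβ : β i ≠ 0) :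
    (content α β).map (Equiv.swap (circ i) (circBar i)) = content α β := by
  have h1 : (content α β).count (circ i) = 1 := by
    rw [circ, count_content]
    simp [side, hβ]
  have h2 : (content α β).count (circBar i) = 1 := by
    rw [circBar, count_content]
    simp [side, hα]
  ext a
  obtain ⟨b, rfl⟩ := (Equiv.swap (circ i) (circBar i)).surjective a
  rw [Multiset.count_map_eq_count' _ _ (Equiv.injective _)]
  rcases eq_or_ne b (circ i) with rfl | hb
  · rw [Equiv.swap_apply_left, h1, h2]
  · rcases eq_or_ne b (circBar i) with rfl | hb'
    · rw [Equiv.swap_apply_right, h1, h2]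
    · rw [Equiv.swap_apply_of_ne_of_ne hb hb']

theorem wt_swapCircled : wt (swapCircled i T) = wt T := by
  funext p
  simp [wt, swapCircled]

theorem IsDetached.swapCircled {f : Bool} (h : IsDetached α β T i f) :
    IsDetached α β (swapCircled i T) i (!f) := by
  obtain ⟨j, hj, h1, h2, h3, h4, h5⟩ := h
  refine ⟨j, hj, h1, h2, circled_mem_swapCircled.mpr (by simpa using h3),
    circled_mem_swapCircled.mpr (by simpa using h4), fun k x hx hv hc => h5 k x ?_ hv hc⟩
  exact (mem_swapCircled_of_ne (Or.inr hc)).mp hx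

theorem IsDetached.swapCircled_of_ne {f : Bool} {i' : Fin n} (hi : i' ≠ i)
    (h : IsDetached α β T i' f) : IsDetached α β (FundamentalAtom.swapCircled i T) i' f := by
  obtain ⟨j, hj, h1, h2, h3, h4, h5⟩ := h
  refine ⟨j, hj, h1, h2, (mem_swapCircled_of_ne (Or.inl hi)).mpr h3,
    (mem_swapCircled_of_ne (Or.inl hi)).mpr h4, fun k x hx hv hc => h5 k x ?_ hv hc⟩
  exact (mem_swapCircled_of_ne (Or.inr hc)).mp hx

/-- The range condition needed after recolouring: both circled letters of a detached value respect
the left bounds of both colours. -/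
theorem IsDetached.leftBound_le {f : Bool} (hT : IsFilling α β T) (h : IsDetached α β T i f)
    {g : Bool} {p : Fin n} (hp : (⟨i, g, true⟩ : Letter n) ∈ T p) (s : Bool) :
    leftBound (side α β s) i ≤ p.val := by
  obtain ⟨j, hj, h1, h2, h3, h4, -⟩ := h
  by_cases hgf : g = f
  · subst hgf
    obtain rfl := hT.pos_unique hp h3
    cases s <;> assumption
  · obtain rfl : g = !f := by cases g <;> cases f <;> simp_all
    obtain rfl := hT.pos_unique hp h4
    exact leftBound_le_self _ _

theorem IsLooseAtomPartition.swapCircled {f : Bool} (hT : IsLooseAtomPartition α β T)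
    (hα : α i ≠ 0) (hβ : β i ≠ 0) (hd : IsDetached α β T i f) :
    IsLooseAtomPartition α β (swapCircled i T) := by
  refine ⟨⟨?_, fun p x hx => ?_⟩, fun i' g h1 h2 => ?_, fun i' hα' hβ' => ?_⟩
  · rw [← content_map_swap hα hβ, ← hT.partition]
    exact (map_sum (Multiset.mapAddMonoidHom (Equiv.swap (circ i) (circBar i))) T _).symm
  · by_cases hxi : x.value ≠ i ∨ x.circled = false
    · exact hT.range p x ((mem_swapCircled_of_ne hxi).mp hx)
    · obtain ⟨v, b, c⟩ := x
      simp only [not_or, not_not, Bool.not_eq_false] at hxi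
      obtain ⟨rfl, rfl⟩ := hxi
      have hx' := circled_mem_swapCircled.mp hx
      exact ⟨hd.leftBound_le hT.toIsFilling hx' _, (hT.range p _ hx').2⟩
  · have hne : i' ≠ i := by
      rintro rfl
      cases g
      · exact hα h2
      · exact hβ h2
    exact (mem_swapCircled_of_ne (Or.inl hne)).mpr (hT.single i' g h1 h2)
  · rcases eq_or_ne i' i with rfl | hne
    · exact Or.inr ⟨_, hd.swapCircled⟩
    · rcases hT.double i' hα' hβ' with ⟨h1, h2⟩ | ⟨g, hg⟩
      · exact Or.inl ⟨(mem_swapCircled_of_ne (Or.inl hne)).mpr h1,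
          (mem_swapCircled_of_ne (Or.inl hne)).mpr h2⟩
      · exact Or.inr ⟨g, hg.swapCircled_of_ne hne⟩

theorem IsDetached.sgn_eq (hT : IsLooseAtomPartition α β T) (hd : IsDetached α β T i false) :
    sgn T = sgn (FundamentalAtom.swapCircled i T) + 1 := by
  obtain ⟨j, hj, -, -, h3, h4, -⟩ := hd
  -- The exchange affects only the value `i`, which stops being counted.
  rw [sgn, sgn, ← Set.ncard_insert_of_notMem (a := i)]
  · congr 1
    ext i'
    rw [Set.mem_insert_iff]
    rcases eq_or_ne i' i with rfl | hne
    · simp only [true_or, iff_true]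
      exact ⟨j, i', hj, h3, h4⟩
    · have hv : ∀ p f, (⟨i', f, true⟩ : Letter n) ∈ FundamentalAtom.swapCircled i T p ↔
          (⟨i', f, true⟩ : Letter n) ∈ T p := fun p f => mem_swapCircled_of_ne (Or.inl hne)
      simp only [hne, false_or, Set.mem_ofPred_eq, circ, circBar, hv]
  · rintro ⟨p, q, hpq, hp, hq⟩
    have e1 := hT.pos_unique (circled_mem_swapCircled.mp hp) h4
    have e2 := hT.pos_unique (circled_mem_swapCircled.mp hq) h3
    subst e1 e2
    exact absurd hj hpq.not_gt

theorem IsDetached.sign_swapCircled {f : Bool} (hT : IsLooseAtomPartition α β T)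
    (hα : α i ≠ 0) (hβ : β i ≠ 0) (hd : IsDetached α β T i f) :
    (-1 : ℂ) ^ sgn T + (-1) ^ sgn (FundamentalAtom.swapCircled i T) = 0 := by
  cases f
  · rw [hd.sgn_eq hT, pow_succ]
    ring
  · have h := IsDetached.sgn_eq (hT.swapCircled hα hβ hd) hd.swapCircled
    rw [swapCircled_swapCircled] at h
    rw [h, pow_succ]
    ring

theorem IsDetached.swapCircled_ne {f : Bool} (hT : IsFilling α β T)
    (hd : IsDetached α β T i f) : FundamentalAtom.swapCircled i T ≠ T := by
  intro h
  obtain ⟨j, hj, -, -, h3, h4, -⟩ := id hd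
  obtain ⟨-, -, -, -, -, h4', -⟩ := hd.swapCircled
  rw [h] at h4'
  rw [Bool.not_not] at h4'
  exact hj.ne (hT.pos_unique h3 h4')

end swapCircled

/-! ### Signed sums over loose atom partitions -/

theorem looseAtomPartitions_finite {n : ℕ} (α β m : Fin n → ℕ) :
    {T : Fin n → Multiset (Letter n) | IsLooseAtomPartition α β T ∧ wt T = m}.Finite := by
  refine (Set.Finite.pi' (t := fun _ : Fin n => Set.Iic (content α β))
    fun _ => Set.finite_Iic _).subset ?_
  intro S hS p
  rw [Set.mem_Iic, ← hS.1.partition]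
  exact Finset.single_le_sum (f := S) (fun _ _ => Multiset.zero_le _) (Finset.mem_univ p)

-- The bijection sends `S` to its splitting of weight `m`, with inverse the merging of the weakly
-- decreasing runs.
open Classical in
theorem sum_qamp_eq {n : ℕ} (α β m : Fin n → ℕ) :
    ∑ S ∈ (qamp_finite α β).toFinset with IsRefinement (wt S) m, (-1 : ℂ) ^ sgn S =
      ∑ T ∈ (looseAtomPartitions_finite α β m).toFinset, (-1 : ℂ) ^ sgn T := by
  have hex : ∀ S : Fin n → Multiset (Letter n), IsRefinement (wt S) m →
      ∃ T : Fin n → Multiset (Letter n), IsSplitting S T ∧ ∀ p, (T p).card = m p :=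
    fun S h => exists_isSplitting S m h
  choose! U hU1 hU2 using hex
  have hmem : ∀ S, S ∈ (qamp_finite α β).toFinset.filter (fun S => IsRefinement (wt S) m) ↔
      IsAtomPartition α β S ∧ IsRefinement (wt S) m := by
    simp [qamp]
  have hmem' : ∀ T, T ∈ (looseAtomPartitions_finite α β m).toFinset ↔
      IsLooseAtomPartition α β T ∧ wt T = m := by
    simp
  refine Finset.sum_bij (fun S _ => U S) ?_ ?_ ?_ ?_
  · intro S hS
    rw [hmem] at hS
    rw [hmem']
    exact ⟨(hU1 S hS.2).isLooseAtomPartition hS.1, funext (hU2 S hS.2)⟩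
  · intro S hS S' hS' heq
    rw [hmem] at hS hS'
    exact (hU1 S hS.2).unique_left (heq ▸ hU1 S' hS'.2) hS.1.hasAscents hS'.1.hasAscents
  · intro T hT
    rw [hmem'] at hT
    obtain ⟨S, hST, hasc⟩ := exists_merging T
    have hr : IsRefinement (wt S) m := hT.2 ▸ hST.isRefinement
    refine ⟨S, (hmem S).mpr ⟨hST.isAtomPartition hasc hT.1, hr⟩, ?_⟩
    exact (hU1 S hr).unique_right hST fun p => (hU2 S hr p).trans (congrFun hT.2 p).symm
  · intro S hS
    rw [hmem] at hS
    rw [(hU1 S hS.2).sgn_eq hS.1]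

theorem exists_isDetached_of_wt_le_one {n : ℕ} {α β : Fin n → ℕ}
    {T : Fin n → Multiset (Letter n)} (hT : IsLooseAtomPartition α β T) {i : Fin n}
    (hα : α i ≠ 0) (hβ : β i ≠ 0) (hw : wt T i ≤ 1) : ∃ f, IsDetached α β T i f := by
  rcases hT.double i hα hβ with ⟨h1, h2⟩ | h
  · have hle : ({circ i, circBar i} : Multiset (Letter n)) ≤ T i := by
      rw [Multiset.insert_eq_cons, Multiset.cons_le_of_notMem]
      · exact ⟨h2, Multiset.singleton_le.mpr h1⟩
      · simpa using (circ_lt_circBar i).ne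
    have := Multiset.card_le_card hle
    simp only [Multiset.insert_eq_cons, Multiset.card_cons, Multiset.card_singleton] at this
    simp only [wt] at hw
    omega
  · exact h

/-- A part of size at most one cannot hold both circled letters of value `i`, so one of them is
detached in every summand. Exchanging them keeps the weight and reverses the sign. -/
theorem sum_loose_eq_zero {n : ℕ} {α β m : Fin n → ℕ} {i : Fin n} (hα : α i ≠ 0) (hβ : β i ≠ 0)
    (hm : m i ≤ 1) :
    ∑ T ∈ (looseAtomPartitions_finite α β m).toFinset, (-1 : ℂ) ^ sgn T = 0 := by
  have hd : ∀ T, T ∈ (looseAtomPartitions_finite α β m).toFinset →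
      IsLooseAtomPartition α β T ∧ wt T = m ∧ ∃ f, IsDetached α β T i f := by
    intro T hT
    obtain ⟨h1, h2⟩ : IsLooseAtomPartition α β T ∧ wt T = m := by simpa using hT
    exact ⟨h1, h2, exists_isDetached_of_wt_le_one h1 hα hβ (h2 ▸ hm)⟩
  refine Finset.sum_involution (fun T _ => swapCircled i T) ?_ ?_ ?_ ?_
  · intro T hT
    obtain ⟨h1, -, f, hf⟩ := hd T hT
    exact hf.sign_swapCircled h1 hα hβ
  · intro T hT _
    obtain ⟨h1, -, f, hf⟩ := hd T hT
    exact hf.swapCircled_ne h1.toIsFilling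
  · intro T hT
    obtain ⟨h1, h2, f, hf⟩ := hd T hT
    simpa [wt_swapCircled, h2] using h1.swapCircled hα hβ hf
  · intro T _
    exact swapCircled_swapCircled

/-! ### Fillings with all circled letters in their rightmost position -/

/-- Each circled letter is in the position given by its value. -/
structure IsTightFilling {n : ℕ} (α β : Fin n → ℕ) (T : Fin n → Multiset (Letter n)) : Prop
    extends IsFilling α β T where
  circled_mem : ∀ i f, side α β f i ≠ 0 → (⟨i, f, true⟩ : Letter n) ∈ T i

theorem IsTightFilling.isLooseAtomPartition {n : ℕ} {α β : Fin n → ℕ}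
    {T : Fin n → Multiset (Letter n)} (hT : IsTightFilling α β T) : IsLooseAtomPartition α β T :=
  ⟨hT.toIsFilling, fun i f h _ => hT.circled_mem i f h,
    fun i hα hβ => Or.inl ⟨hT.circled_mem i true hα, hT.circled_mem i false hβ⟩⟩

theorem IsTightFilling.sgn_eq_zero {n : ℕ} {α β : Fin n → ℕ}
    {T : Fin n → Multiset (Letter n)} (hT : IsTightFilling α β T) : sgn T = 0 := by
  rw [sgn, Set.ncard_eq_zero]
  refine Set.eq_empty_of_forall_notMem fun i hi => ?_
  obtain ⟨p, q, hpq, hp, hq⟩ := hi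
  have e1 := hT.pos_unique hp (hT.circled_mem i false (hT.side_ne_zero hp))
  have e2 := hT.pos_unique hq (hT.circled_mem i true (hT.side_ne_zero hq))
  exact hpq.ne (e1.trans e2.symm)

/-- A detached value `i` would leave just one letter in position `i`. -/
theorem IsLooseAtomPartition.isTightFilling {n : ℕ} {α β : Fin n → ℕ}
    {T : Fin n → Multiset (Letter n)} (hT : IsLooseAtomPartition α β T)
    (h : ∀ i, α i ≠ 0 → β i ≠ 0 → 1 < wt T i) : IsTightFilling α β T := by
  refine ⟨hT.toIsFilling, fun i f hi => ?_⟩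
  by_cases hi' : side α β (!f) i = 0
  · exact hT.single i f hi hi'
  · have hα : α i ≠ 0 := by cases f <;> assumption
    have hβ : β i ≠ 0 := by cases f <;> assumption
    rcases hT.double i hα hβ with ⟨h1, h2⟩ | ⟨g, hg⟩
    · cases f
      · exact h2
      · exact h1
    · exfalso
      have hall : ∀ x ∈ T i, x = ⟨i, !g, true⟩ := fun x hx =>
        hg.eq_circled hT.toIsFilling hα hβ hx
      have hcount : (T i).count ⟨i, !g, true⟩ ≤ 1 :=
        (Finset.single_le_sum (f := fun r => (T r).count (⟨i, !g, true⟩ : Letter n))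
          (fun _ _ => Nat.zero_le _) (Finset.mem_univ i)).trans (hT.count_circled_le i _)
      have := h i hα hβ
      rw [wt, ← Multiset.count_eq_card.mpr fun x hx => (hall x hx).symm] at this
      omega

theorem nextNonzero_iff_leftBound {n : ℕ} {γ : Fin n → ℕ} {p i : Fin n} :
    NextNonzero γ p i ↔ γ i ≠ 0 ∧ leftBound γ i ≤ p.val ∧ p ≤ i := by
  rw [leftBound_le_iff]
  constructor
  · rintro ⟨h1, h2, h3⟩
    refine ⟨h2, fun r hr hγ => ?_, h1⟩
    by_contra hle
    exact hγ (h3 r (not_lt.mp hle) hr)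
  · rintro ⟨h1, h2, h3⟩
    refine ⟨h3, h1, fun r hr hri => ?_⟩
    by_contra hγ
    exact absurd (h2 r hri hγ) (not_lt.mpr hr)

theorem IsFilling.nextNonzero {n : ℕ} {α β : Fin n → ℕ} {T : Fin n → Multiset (Letter n)}
    (h : IsFilling α β T) {p : Fin n} {x : Letter n} (hx : x ∈ T p) :
    NextNonzero (side α β x.barred) p x.value :=
  nextNonzero_iff_leftBound.mpr ⟨h.side_ne_zero hx, h.range p x hx⟩

/-- The numbers of barred (unbarred) letters in the parts of `T`. -/
def partialWt {n : ℕ} (T : Fin n → Multiset (Letter n)) (f : Bool) : Fin n → ℕ :=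
  fun p => (T p).countP fun x => x.barred = f

theorem partialWt_add {n : ℕ} (T : Fin n → Multiset (Letter n)) (p : Fin n) :
    partialWt T true p + partialWt T false p = wt T p := by
  have := Multiset.card_eq_countP_add_countP (fun x : Letter n => x.barred = true) (T p)
  simp only [Bool.not_eq_true] at this
  exact this.symm

theorem countP_eq_count_add_count {n : ℕ} {s : Multiset (Letter n)} {i : Fin n} {f : Bool}
    (h : ∀ x ∈ s, x.barred = f → x.value = i) :
    s.countP (fun x => x.barred = f) = s.count ⟨i, f, false⟩ + s.count ⟨i, f, true⟩ := by
  induction s using Multiset.induction with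
  | empty => simp
  | cons a s ih =>
    rw [Multiset.countP_cons, Multiset.count_cons, Multiset.count_cons,
      ih fun x hx => h x (Multiset.mem_cons_of_mem hx)]
    have ha := h a (Multiset.mem_cons_self _ _)
    obtain ⟨v, b, c⟩ := a
    by_cases hb : b = f
    · obtain rfl : v = i := ha hb
      subst hb
      cases c <;> simp <;> omega
    · simp [hb, Ne.symm hb]

section Tight

variable {n : ℕ} {α β : Fin n → ℕ} {T T' : Fin n → Multiset (Letter n)}

theorem IsFilling.partialWt_eq (h : IsFilling α β T) {f : Bool} {p i : Fin n}
    (hp : NextNonzero (side α β f) p i) :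
    partialWt T f p = (T p).count ⟨i, f, false⟩ + (T p).count ⟨i, f, true⟩ := by
  refine countP_eq_count_add_count fun x hx hb => ?_
  have := h.nextNonzero hx
  rw [hb] at this
  exact this.unique hp

theorem IsFilling.count_eq_zero (h : IsFilling α β T) {f c : Bool} {p i : Fin n}
    (hp : ¬ NextNonzero (side α β f) p i) : (T p).count ⟨i, f, c⟩ = 0 :=
  Multiset.count_eq_zero_of_notMem fun hx => hp (h.nextNonzero hx)

theorem IsTightFilling.count_circled (h : IsTightFilling α β T) {f : Bool} {p i : Fin n}
    (hi : side α β f i ≠ 0) : (T p).count ⟨i, f, true⟩ = if p = i then 1 else 0 := by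
  have hm := h.circled_mem i f hi
  split_ifs with hp
  · subst hp
    have h1 := h.count_circled_le p f
    have h2 := Finset.single_le_sum (f := fun r => (T r).count (⟨p, f, true⟩ : Letter n))
      (fun _ _ => Nat.zero_le _) (Finset.mem_univ p)
    have h3 := Multiset.count_pos.mpr hm
    omega
  · exact Multiset.count_eq_zero_of_notMem fun hx => hp (h.pos_unique hx hm)

/-- The position and colour of a letter force its value, and the circled letters have fixed
positions; only the numbers of uncircled letters remain free. -/
theorem IsTightFilling.ext_partialWt (h : IsTightFilling α β T) (h' : IsTightFilling α β T')
    (hw : ∀ f, partialWt T f = partialWt T' f) : T = T' := by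
  funext p
  ext ⟨i, f, c⟩
  by_cases hp : NextNonzero (side α β f) p i
  · have e := h.partialWt_eq hp
    have e' := h'.partialWt_eq hp
    have c1 := h.count_circled (p := p) hp.2.1
    have c2 := h'.count_circled (p := p) hp.2.1
    rw [hw f] at e
    cases c <;> omega
  · rw [h.count_eq_zero hp, h'.count_eq_zero hp]

theorem IsTightFilling.isRefinement (h : IsTightFilling α β T) (f : Bool) :
    IsRefinement (side α β f) (partialWt T f) := by
  classical
  rw [isRefinement_iff]
  refine ⟨fun q hq => ?_, fun q hq => ?_, fun p hp => ?_⟩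
  · rw [partialWt, ← Nat.pos_iff_ne_zero, Multiset.countP_pos]
    exact ⟨_, h.circled_mem q f hq, rfl⟩
  · have hs : ∀ c, ∑ p with NextNonzero (side α β f) p q, (T p).count ⟨q, f, c⟩ =
        (content α β).count ⟨q, f, c⟩ := by
      intro c
      rw [← h.partition, Multiset.count_sum', Finset.sum_filter_of_ne]
      intro p _ hne
      by_contra hp
      exact hne (h.count_eq_zero hp)
    have e : ∑ p with NextNonzero (side α β f) p q, partialWt T f p =
        ∑ p with NextNonzero (side α β f) p q,
          ((T p).count ⟨q, f, false⟩ + (T p).count ⟨q, f, true⟩) :=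
      Finset.sum_congr rfl fun p hp => h.partialWt_eq (Finset.mem_filter.mp hp).2
    rw [e, Finset.sum_add_distrib, hs, hs, count_content, count_content]
    simp [hq]
    omega
  · rw [partialWt, Multiset.countP_eq_zero]
    rintro x hx rfl
    exact hp _ (h.nextNonzero hx)

/-- The barred (unbarred) letters of the tight filling with prescribed numbers of such letters. -/
noncomputable def fillLetters (γ b : Fin n → ℕ) (f : Bool) (p : Fin n) : Multiset (Letter n) :=
  open Classical in
  ∑ i with NextNonzero γ p i, if p = i then Multiset.replicate (b p - 1) ⟨i, f, false⟩ +
    {⟨i, f, true⟩} else Multiset.replicate (b p) ⟨i, f, false⟩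

theorem fillLetters_eq {γ b : Fin n → ℕ} {f : Bool} {p i : Fin n} (h : NextNonzero γ p i) :
    fillLetters γ b f p = if p = i then Multiset.replicate (b p - 1) ⟨i, f, false⟩ +
      {⟨i, f, true⟩} else Multiset.replicate (b p) ⟨i, f, false⟩ := by
  classical
  have : Finset.univ.filter (fun q => NextNonzero γ p q) = {i} := by
    ext r
    simp only [Finset.mem_filter, Finset.mem_univ, true_and, Finset.mem_singleton]
    exact ⟨fun hr => hr.unique h, fun hr => hr ▸ h⟩
  rw [fillLetters]
  convert Finset.sum_singleton _ i

theorem mem_fillLetters {γ b : Fin n → ℕ} {f : Bool} {p : Fin n} {x : Letter n}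
    (h : x ∈ fillLetters γ b f p) : x.barred = f ∧ NextNonzero γ p x.value := by
  classical
  obtain ⟨i, hi, hx⟩ := Multiset.mem_sum.mp h
  have hi' : NextNonzero γ p i := by simpa using hi
  split_ifs at hx
  · rcases Multiset.mem_add.mp hx with h1 | h1
    · obtain rfl := Multiset.eq_of_mem_replicate h1
      exact ⟨rfl, hi'⟩
    · obtain rfl := Multiset.mem_singleton.mp h1
      exact ⟨rfl, hi'⟩
  · obtain rfl := Multiset.eq_of_mem_replicate hx
    exact ⟨rfl, hi'⟩

theorem countP_fillLetters {γ b : Fin n → ℕ} (hb : IsRefinement γ b) (f g : Bool) (p : Fin n) :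
    (fillLetters γ b f p).countP (fun x => x.barred = g) = if f = g then b p else 0 := by
  classical
  rw [isRefinement_iff] at hb
  split_ifs with h
  · subst h
    rw [Multiset.countP_eq_card.mpr fun x hx => (mem_fillLetters hx).1]
    by_cases hp : ∃ i, NextNonzero γ p i
    · obtain ⟨i, hi⟩ := hp
      rw [fillLetters_eq hi]
      split_ifs with hpi
      · subst hpi
        have := hb.1 p hi.2.1
        simp only [Multiset.card_add, Multiset.card_replicate, Multiset.card_singleton]
        omega
      · simp
    · rw [hb.2.2 p (not_exists.mp hp), Multiset.card_eq_zero]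
      exact Multiset.eq_zero_of_forall_notMem fun x hx => hp ⟨_, (mem_fillLetters hx).2⟩
  · rw [Multiset.countP_eq_zero]
    rintro x hx rfl
    exact h (mem_fillLetters hx).1.symm

theorem sum_fillLetters {γ b : Fin n → ℕ} (hb : IsRefinement γ b) (f : Bool) :
    ∑ p, fillLetters γ b f p = ∑ i, if γ i ≠ 0 then
      Multiset.replicate (γ i - 1) (⟨i, f, false⟩ : Letter n) + {⟨i, f, true⟩} else 0 := by
  classical
  rw [isRefinement_iff] at hb
  simp only [fillLetters]
  simp_rw [Finset.sum_filter]
  rw [Finset.sum_comm]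
  refine Finset.sum_congr rfl fun i _ => ?_
  rw [← Finset.sum_filter]
  split_ifs with hi
  · have hmem : i ∈ Finset.univ.filter (fun p => NextNonzero γ p i) := by
      simpa using nextNonzero_self hi
    have hsum := hb.2.1 i hi
    rw [← Finset.add_sum_erase _ _ hmem] at hsum ⊢
    rw [if_pos rfl]
    have e : ∀ p ∈ (Finset.univ.filter (fun p => NextNonzero γ p i)).erase i,
        (if p = i then Multiset.replicate (b p - 1) (⟨i, f, false⟩ : Letter n) + {⟨i, f, true⟩}
          else Multiset.replicate (b p) ⟨i, f, false⟩) =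
        Multiset.replicateAddMonoidHom (⟨i, f, false⟩ : Letter n) (b p) := fun p hp => by
      rw [if_neg (Finset.ne_of_mem_erase hp)]
      rfl
    rw [Finset.sum_congr rfl e, ← map_sum]
    have := hb.1 i hi
    -- The truncated subtractions are harmless because `b i ≠ 0`: one unit at `i` is the circled
    -- letter.
    have e2 : γ i - 1 = (b i - 1) +
        ∑ p ∈ (Finset.univ.filter (fun p => NextNonzero γ p i)).erase i, b p := by omega
    rw [e2, Multiset.replicate_add, add_right_comm]
    rfl
  · exact Finset.sum_eq_zero fun p hp => absurd (Finset.mem_filter.mp hp).2.2.1 hi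

theorem exists_isTightFilling {b c : Fin n → ℕ} (hb : IsRefinement α b) (hc : IsRefinement β c) :
    ∃ T, IsTightFilling α β T ∧ partialWt T true = b ∧ partialWt T false = c := by
  refine ⟨fun p => fillLetters α b true p + fillLetters β c false p, ⟨⟨?_, ?_⟩, ?_⟩, ?_, ?_⟩
  · rw [Finset.sum_add_distrib, sum_fillLetters hb, sum_fillLetters hc]
    rfl
  · intro p x hx
    rcases Multiset.mem_add.mp hx with h | h
    · obtain ⟨h1, h2⟩ := mem_fillLetters h
      rw [h1]
      exact (nextNonzero_iff_leftBound.mp h2).2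
    · obtain ⟨h1, h2⟩ := mem_fillLetters h
      rw [h1]
      exact (nextNonzero_iff_leftBound.mp h2).2
  · intro i f hi
    rw [Multiset.mem_add]
    cases f
    · right
      rw [fillLetters_eq (nextNonzero_self (show β i ≠ 0 from hi))]
      simp
    · left
      rw [fillLetters_eq (nextNonzero_self (show α i ≠ 0 from hi))]
      simp
  · funext p
    simp [partialWt, countP_fillLetters hb, countP_fillLetters hc]
  · funext p
    simp [partialWt, countP_fillLetters hb, countP_fillLetters hc]

open Classical in
theorem card_tightFillings (α β : Fin n → ℕ) (m : Fin n →₀ ℕ)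
    (s : Finset (Fin n → Multiset (Letter n)))
    (hs : ∀ T, T ∈ s ↔ IsTightFilling α β T ∧ wt T = m) :
    s.card = ((Finset.HasAntidiagonal.antidiagonal m).filter fun x =>
        IsRefinement α x.1 ∧ IsRefinement β x.2).card := by
  refine Finset.card_bij (fun T _ => (Finsupp.equivFunOnFinite.symm (partialWt T true),
    Finsupp.equivFunOnFinite.symm (partialWt T false))) ?_ ?_ ?_
  · intro T hT
    rw [hs] at hT
    rw [Finset.mem_filter, Finset.HasAntidiagonal.mem_antidiagonal]
    refine ⟨?_, hT.1.isRefinement true, hT.1.isRefinement false⟩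
    ext p
    simpa [hT.2] using partialWt_add T p
  · intro T hT T' hT' heq
    rw [hs] at hT hT'
    simp only [Prod.mk.injEq, EmbeddingLike.apply_eq_iff_eq] at heq
    exact hT.1.ext_partialWt hT'.1 fun f => by cases f; exacts [heq.2, heq.1]
  · rintro ⟨b, c⟩ hx
    rw [Finset.mem_filter, Finset.HasAntidiagonal.mem_antidiagonal] at hx
    obtain ⟨T, hT, h1, h2⟩ := exists_isTightFilling hx.2.1 hx.2.2
    refine ⟨T, (hs T).mpr ⟨hT, ?_⟩, ?_⟩
    · funext p
      rw [← partialWt_add, h1, h2, ← hx.1]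
      rfl
    · rw [Prod.mk.injEq, h1, h2]
      exact ⟨Finsupp.ext fun _ => rfl, Finsupp.ext fun _ => rfl⟩

open Classical in
theorem sum_loose_eq_card (α β : Fin n → ℕ) (m : Fin n →₀ ℕ) :
    ∑ T ∈ (looseAtomPartitions_finite α β m).toFinset, (-1 : ℂ) ^ sgn T =
      ((Finset.HasAntidiagonal.antidiagonal m).filter fun x =>
        IsRefinement α x.1 ∧ IsRefinement β x.2).card := by
  by_cases h : ∀ i, α i ≠ 0 → β i ≠ 0 → 1 < m i
  · rw [← card_tightFillings α β m (looseAtomPartitions_finite α β m).toFinset]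
    · rw [Finset.card_eq_sum_ones, Nat.cast_sum]
      refine Finset.sum_congr rfl fun T hT => ?_
      obtain ⟨h1, h2⟩ : IsLooseAtomPartition α β T ∧ wt T = m := by simpa using hT
      rw [(h1.isTightFilling fun i hα hβ => h2 ▸ h i hα hβ).sgn_eq_zero]
      simp
    · intro T
      simp only [Set.Finite.mem_toFinset, Set.mem_ofPred_eq]
      exact ⟨fun ⟨h1, h2⟩ => ⟨h1.isTightFilling fun i hα hβ => h2 ▸ h i hα hβ, h2⟩,
        fun ⟨h1, h2⟩ => ⟨h1.isLooseAtomPartition, h2⟩⟩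
  · push Not at h
    obtain ⟨i, hα, hβ, hm⟩ := h
    rw [sum_loose_eq_zero hα hβ hm, eq_comm, Nat.cast_eq_zero, Finset.card_eq_zero,
      Finset.filter_eq_empty_iff]
    rintro ⟨b, c⟩ hx ⟨h1, h2⟩
    rw [Finset.HasAntidiagonal.mem_antidiagonal] at hx
    have hb := (h1.1 i hα).1
    have hc := (h2.1 i hβ).1
    have : b i + c i = m i := DFunLike.congr_fun hx i
    simp only at hb hc
    omega

end Tight

/-! ### Monomial expansions -/

theorem refinements_finite {n : ℕ} (c : Fin n → ℕ) :
    {m : Fin n →₀ ℕ | IsRefinement c m}.Finite := by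
  refine ((Set.finite_Iic (Finsupp.equivFunOnFinite.symm fun _ => ∑ p, c p))).subset ?_
  intro m hm
  rw [Set.mem_Iic]
  intro p
  have h : ∑ p, m p = ∑ p, c p := hm.2
  rw [Finsupp.equivFunOnFinite_symm_apply_apply, ← h]
  exact Finset.single_le_sum (f := m) (fun _ _ => Nat.zero_le _) (Finset.mem_univ p)

/-- The sum of the monomials whose exponent vectors are refinements of `c`. -/
noncomputable def refinementSum {n : ℕ} (c : Fin n → ℕ) : MvPolynomial (Fin n) ℂ :=
  ∑ m ∈ (refinements_finite c).toFinset, monomial m 1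

open Classical in
theorem coeff_refinementSum {n : ℕ} (c : Fin n → ℕ) (m : Fin n →₀ ℕ) :
    coeff m (refinementSum c) = if IsRefinement c m then 1 else 0 := by
  rw [refinementSum, coeff_sum]
  simp only [coeff_monomial]
  rw [Finset.sum_ite_eq']
  simp

section Step

variable {n : ℕ} (i : AdjPos n)

theorem quasiSwapExp_apply (m : Fin n →₀ ℕ) (p : Fin n) :
    quasiSwapExp i m p =
      if m i.1 = 0 ∨ m i.right = 0 then m (Equiv.swap i.1 i.right p) else m p := by
  rw [quasiSwapExp]
  split_ifs with h
  · rw [simpleTransposition, Finsupp.mapDomain_equiv_apply, Equiv.symm_swap]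
  · rfl

theorem quasiSwapExp_quasiSwapExp (m : Fin n →₀ ℕ) :
    quasiSwapExp i (quasiSwapExp i m) = m := by
  ext p
  simp only [quasiSwapExp_apply, Equiv.swap_apply_left, Equiv.swap_apply_right]
  by_cases h : m i.1 = 0 ∨ m i.right = 0
  · simp only [h, h.symm, if_true, Equiv.swap_apply_self]
  · simp only [h, if_false]

theorem coeff_quasiSwap (f : MvPolynomial (Fin n) ℂ) (m : Fin n →₀ ℕ) :
    coeff m (quasiSwap i f) = coeff (quasiSwapExp i m) f := by
  classical
  induction f using MvPolynomial.induction_on' with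
  | monomial k c =>
    rw [quasiSwap_monomial, coeff_monomial, coeff_monomial]
    refine if_congr ⟨fun h => ?_, fun h => ?_⟩ rfl rfl
    · rw [← h, quasiSwapExp_quasiSwapExp]
    · rw [h, quasiSwapExp_quasiSwapExp]
  | add p q hp hq => rw [map_add, coeff_add, coeff_add, hp, hq]

/-- The quotient is determined by its defining equation, as polynomials over `ℂ` have no zero
divisors; thus no explicit division is needed. -/
theorem quasiTheta_eq_of_mul_eq {f g : MvPolynomial (Fin n) ℂ}
    (h : X i.right * (f - quasiSwap i f) = (X i.1 - X i.right) * g) : quasiTheta i f = g := by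
  rw [quasiDiff_spec, mul_left_comm] at h
  refine mul_left_cancel₀ ?_ h
  rw [sub_ne_zero]
  exact fun h => i.ne_right (X_injective h)

theorem AdjPos.lt_right : i.1 < i.right := by
  rw [Fin.lt_def]
  simp [AdjPos.right]

theorem AdjPos.Iic_right : Finset.Iic i.right = insert i.right (Finset.Iic i.1) := by
  ext p
  simp only [Finset.mem_Iic, Finset.mem_insert, Fin.le_def, Fin.ext_iff, AdjPos.right]
  omega

theorem AdjPos.sum_Iic_right (f : Fin n → ℕ) :
    ∑ p ∈ Finset.Iic i.right, f p = f i.right + ∑ p ∈ Finset.Iic i.1, f p := by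
  rw [i.Iic_right, Finset.sum_insert]
  simpa using i.lt_right

variable {i} in
theorem sum_eq_of_eq_off {f g : Fin n → ℕ} (h : ∀ p, p ≠ i.1 → p ≠ i.right → f p = g p)
    (h' : f i.1 + f i.right = g i.1 + g i.right) (s : Finset (Fin n))
    (hs : i.1 ∈ s ↔ i.right ∈ s) : ∑ p ∈ s, f p = ∑ p ∈ s, g p := by
  by_cases hi : i.1 ∈ s
  · have hsub : {i.1, i.right} ⊆ s := by
      intro p hp
      rw [Finset.mem_insert, Finset.mem_singleton] at hp
      rcases hp with rfl | rfl
      exacts [hi, hs.mp hi]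
    rw [← Finset.sum_sdiff hsub, ← Finset.sum_sdiff hsub, Finset.sum_pair i.ne_right,
      Finset.sum_pair i.ne_right, h']
    congr 1
    refine Finset.sum_congr rfl fun p hp => ?_
    simp only [Finset.mem_sdiff, Finset.mem_insert, Finset.mem_singleton, not_or] at hp
    exact h p hp.2.1 hp.2.2
  · refine Finset.sum_congr rfl fun p hp => h p ?_ ?_
    · rintro rfl
      exact hi hp
    · rintro rfl
      exact hi (hs.mpr hp)

theorem AdjPos.mem_Iic_iff {q : Fin n} (hq : q ≠ i.1) :
    i.1 ∈ Finset.Iic q ↔ i.right ∈ Finset.Iic q := by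
  rw [ne_eq, Fin.ext_iff] at hq
  simp only [Finset.mem_Iic, Fin.le_def, AdjPos.right]
  omega

/-- Move the entry in position `i + 1` to position `i`. -/
def mergeRight (m : Fin n → ℕ) : Fin n → ℕ :=
  fun p => if p = i.1 then m i.1 + m i.right else if p = i.right then 0 else m p

theorem mergeRight_left (m : Fin n → ℕ) : mergeRight i m i.1 = m i.1 + m i.right := by
  simp [mergeRight]

theorem mergeRight_right (m : Fin n → ℕ) : mergeRight i m i.right = 0 := by
  simp [mergeRight, i.ne_right.symm]

theorem mergeRight_of_ne (m : Fin n → ℕ) {p : Fin n} (h : p ≠ i.1) (h' : p ≠ i.right) :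
    mergeRight i m p = m p := by
  simp [mergeRight, h, h']

/-- The two compositions, and likewise `m` and its merged form, have the same prefix sums except at
`i`. The condition of `c` at `i` becomes that of the swapped composition at `i + 1`, where now
something must remain. -/
theorem isRefinement_swap_iff {c m : Fin n → ℕ} (hi : c i.1 ≠ 0) (hr : c i.right = 0) :
    IsRefinement (fun p => c (simpleTransposition i p)) m ↔
      m i.right ≠ 0 ∧ IsRefinement c (mergeRight i m) := by
  have hcl : c (simpleTransposition i i.1) = c i.right := by simp [simpleTransposition]
  have hcr : c (simpleTransposition i i.right) = c i.1 := by simp [simpleTransposition]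
  have hco : ∀ p, p ≠ i.1 → p ≠ i.right → c (simpleTransposition i p) = c p := fun p h h' => by
    rw [simpleTransposition, Equiv.swap_apply_of_ne_of_ne h h']
  have hc : ∀ s : Finset (Fin n), (i.1 ∈ s ↔ i.right ∈ s) →
      ∑ p ∈ s, c (simpleTransposition i p) = ∑ p ∈ s, c p :=
    sum_eq_of_eq_off (i := i) hco (by rw [hcl, hcr, add_comm])
  have hm : ∀ s : Finset (Fin n), (i.1 ∈ s ↔ i.right ∈ s) →
      ∑ p ∈ s, mergeRight i m p = ∑ p ∈ s, m p :=
    sum_eq_of_eq_off (i := i) (fun p h h' => mergeRight_of_ne i m h h')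
      (by rw [mergeRight_left, mergeRight_right, add_zero])
  have e1 := i.sum_Iic_right c
  have e2 := i.sum_Iic_right (mergeRight i m)
  rw [hr, zero_add] at e1
  rw [mergeRight_right, zero_add] at e2
  have hIr := i.mem_Iic_iff i.ne_right.symm
  constructor
  · rintro ⟨h1, h2⟩
    obtain ⟨h3, h4⟩ := h1 i.right (show c (simpleTransposition i i.right) ≠ 0 by rwa [hcr])
    refine ⟨h3, fun q hq => ?_, ?_⟩
    · rcases eq_or_ne q i.1 with rfl | hqi
      · refine ⟨by rw [mergeRight_left]; omega, ?_⟩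
        rw [← e1, ← e2, hm _ hIr, h4, hc _ hIr]
      · have hqr : q ≠ i.right := by rintro rfl; exact hq hr
        obtain ⟨h5, h6⟩ := h1 q (show c (simpleTransposition i q) ≠ 0 by rwa [hco q hqi hqr])
        refine ⟨by rwa [mergeRight_of_ne i m hqi hqr], ?_⟩
        rw [hm _ (i.mem_Iic_iff hqi), h6, hc _ (i.mem_Iic_iff hqi)]
    · rw [hm _ (by simp), h2, hc _ (by simp)]
  · rintro ⟨h3, h1, h2⟩
    refine ⟨fun q hq => ?_, ?_⟩
    · rcases eq_or_ne q i.right with rfl | hqr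
      · refine ⟨h3, ?_⟩
        have := (h1 i.1 hi).2
        rw [← e1, ← e2] at this
        rw [← hm _ hIr, this, hc _ hIr]
      · have hqi : q ≠ i.1 := by rintro rfl; exact hq (hcl.trans hr)
        replace hq : c (simpleTransposition i q) ≠ 0 := hq
        rw [hco q hqi hqr] at hq
        obtain ⟨h5, h6⟩ := h1 q hq
        rw [mergeRight_of_ne i m hqi hqr] at h5
        refine ⟨h5, ?_⟩
        rw [← hm _ (i.mem_Iic_iff hqi), h6, hc _ (i.mem_Iic_iff hqi)]
    · rw [← hm _ (by simp), h2, hc _ (by simp)]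

/-- Monomials with both exponents nonzero are fixed by `quasiSwap` and vanish. Those with exponents
`(k, 0)`, `k ≥ 1`, give all `(a, b)` with `a + b = k` and `b ≥ 1`, which is the description of the
refinements in `isRefinement_swap_iff`. The proof compares coefficients after clearing the
denominator. -/
theorem quasiTheta_refinementSum {c : Fin n → ℕ} (hi : c i.1 ≠ 0) (hr : c i.right = 0) :
    quasiTheta i (refinementSum c) = refinementSum fun p => c (simpleTransposition i p) := by
  classical
  apply quasiTheta_eq_of_mul_eq
  ext e
  have hne := i.ne_right
  rw [sub_mul, coeff_sub, coeff_X_mul', coeff_X_mul', coeff_X_mul', coeff_sub, coeff_quasiSwap]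
  simp only [coeff_refinementSum, isRefinement_swap_iff i hi hr, Finsupp.mem_support_iff]
  have hpos : ∀ m : Fin n →₀ ℕ, m i.1 = 0 → ¬ IsRefinement c m := fun m hm h => (h.1 _ hi).1 hm
  generalize ha : e - Finsupp.single i.right 1 = a
  generalize hb : e - Finsupp.single i.1 1 = b
  have sr : ∀ p, a p = if p = i.right then e p - 1 else e p := by
    intro p
    rw [← ha, Finsupp.tsub_apply]
    rcases eq_or_ne p i.right with rfl | h
    · simp
    · rw [Finsupp.single_eq_of_ne h, if_neg h, tsub_zero]
  have sl : ∀ p, b p = if p = i.1 then e p - 1 else e p := by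
    intro p
    rw [← hb, Finsupp.tsub_apply]
    rcases eq_or_ne p i.1 with rfl | h
    · simp
    · rw [Finsupp.single_eq_of_ne h, if_neg h, tsub_zero]
  by_cases hy : e i.right = 0
  · simp [hy, sl, hne.symm]
  by_cases hx : e i.1 = 0
  · have hq : ⇑(quasiSwapExp i a) = mergeRight i a := by
      funext p
      rw [quasiSwapExp_apply, if_pos (Or.inl (by rw [sr, if_neg hne, hx]))]
      rcases eq_or_ne p i.1 with rfl | hp
      · rw [Equiv.swap_apply_left, mergeRight_left, sr i.1, if_neg hne, hx, zero_add]
      · rcases eq_or_ne p i.right with rfl | hp'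
        · rw [Equiv.swap_apply_right, mergeRight_right, sr, if_neg hne, hx]
        · rw [Equiv.swap_apply_of_ne_of_ne hp hp', mergeRight_of_ne i _ hp hp']
    have h1 := hpos a (by rw [sr, if_neg hne, hx])
    simp only [hy, hx, h1, hq, ne_eq, not_false_eq_true, not_true_eq_false, if_true, if_false]
    by_cases hy1 : a i.right = 0
    · have h2 := hpos (quasiSwapExp i a) (by
        rw [hq, mergeRight_left, hy1, sr, if_neg hne, hx])
      rw [hq] at h2
      simp [h2]
    · simp [hy1]
  -- Both exponents of `e` are positive. The two right-hand terms then involve the same merged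
  -- vector and cancel, unless the exponent at `i + 1` is `1`.
  · have hm : mergeRight i b = mergeRight i a := by
      funext p
      rcases eq_or_ne p i.1 with rfl | hp
      · rw [mergeRight_left, mergeRight_left, sl, sl, sr, sr, if_pos rfl, if_neg hne.symm,
          if_neg hne, if_pos rfl]
        omega
      · rcases eq_or_ne p i.right with rfl | hp'
        · rw [mergeRight_right, mergeRight_right]
        · rw [mergeRight_of_ne i _ hp hp', mergeRight_of_ne i _ hp hp', sl, sr, if_neg hp,
            if_neg hp']
    have hlr : b i.right = e i.right := by rw [sl, if_neg hne.symm]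
    simp only [hy, hx, hm, hlr, ne_eq, not_false_eq_true, if_true, true_and]
    by_cases hy1 : a i.right = 0
    · have h1 := hpos (quasiSwapExp i a) (by
        rw [quasiSwapExp_apply, if_pos (Or.inr hy1), Equiv.swap_apply_left, hy1])
      have h2 : mergeRight i a = ⇑a := by
        funext p
        rcases eq_or_ne p i.1 with rfl | hp
        · rw [mergeRight_left, hy1, add_zero]
        · rcases eq_or_ne p i.right with rfl | hp'
          · rw [mergeRight_right, hy1]
          · rw [mergeRight_of_ne i _ hp hp']
      simp [h1, h2, hy1]
    · have h1 : quasiSwapExp i a = a := by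
        rw [quasiSwapExp, if_neg]
        rw [not_or]
        exact ⟨by rwa [sr, if_neg hne], hy1⟩
      simp [h1, hy1]

end Step

/-! ### Words that sort the zeros to the right -/

/-- The number of pairs of a zero entry and a nonzero entry further right. -/
def zeroInversions {n : ℕ} (c : Fin n → ℕ) : Finset (Fin n × Fin n) :=
  Finset.univ.filter fun x => x.1 < x.2 ∧ c x.1 = 0 ∧ c x.2 ≠ 0

section Words

variable {n : ℕ}

theorem mem_zeroInversions {c : Fin n → ℕ} {x : Fin n × Fin n} :
    x ∈ zeroInversions c ↔ x.1 < x.2 ∧ c x.1 = 0 ∧ c x.2 ≠ 0 := by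
  simp [zeroInversions]

theorem simpleTransposition_lt (i : AdjPos n) {p q : Fin n} (h : p < q)
    (hne : ¬ (p = i.1 ∧ q = i.right)) :
    simpleTransposition i p < simpleTransposition i q := by
  rw [simpleTransposition, Equiv.swap_apply_def, Equiv.swap_apply_def]
  have hr : i.right.val = i.1.val + 1 := rfl
  simp only [Fin.ext_iff, Fin.lt_def] at *
  split_ifs <;> omega

theorem simpleTransposition_self (i : AdjPos n) (p : Fin n) :
    simpleTransposition i (simpleTransposition i p) = p :=
  Equiv.swap_apply_self _ _ _

/-- The transposition preserves the order of every pair of positions except `(i, i + 1)`, so apart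
from that pair it carries zero inversions to zero inversions. -/
theorem image_zeroInversions_subset (i : AdjPos n) (c : Fin n → ℕ) :
    ((zeroInversions fun p => c (simpleTransposition i p)).erase (i.1, i.right)).image
      (Prod.map (simpleTransposition i) (simpleTransposition i)) ⊆
      (zeroInversions c).erase (i.1, i.right) := by
  intro x hx
  rw [Finset.mem_image] at hx
  obtain ⟨⟨p, q⟩, hpq, rfl⟩ := hx
  rw [Finset.mem_erase, mem_zeroInversions] at hpq
  obtain ⟨hne, hlt, h1, h2⟩ := hpq
  rw [Finset.mem_erase, mem_zeroInversions]
  refine ⟨fun h => ?_, simpleTransposition_lt i hlt (by simpa using hne), h1, h2⟩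
  simp only [Prod.map_apply, Prod.mk.injEq] at h
  have hp : p = i.right := by
    rw [← simpleTransposition_self i p, h.1, simpleTransposition, Equiv.swap_apply_left]
  have hq : q = i.1 := by
    rw [← simpleTransposition_self i q, h.2, simpleTransposition, Equiv.swap_apply_right]
  subst hp hq
  exact absurd i.lt_right hlt.not_gt

theorem card_erase_zeroInversions_le (i : AdjPos n) (c : Fin n → ℕ) :
    ((zeroInversions fun p => c (simpleTransposition i p)).erase (i.1, i.right)).card ≤
      ((zeroInversions c).erase (i.1, i.right)).card := by
  rw [← Finset.card_image_of_injective _ (Function.Injective.prodMap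
    (simpleTransposition i).injective (simpleTransposition i).injective)]
  exact Finset.card_le_card (image_zeroInversions_subset i c)

theorem card_zeroInversions_swap_le (i : AdjPos n) (c : Fin n → ℕ) :
    (zeroInversions fun p => c (simpleTransposition i p)).card ≤ (zeroInversions c).card + 1 := by
  have h1 := card_erase_zeroInversions_le i c
  have h2 := Finset.card_erase_le (s := zeroInversions c) (a := (i.1, i.right))
  have h3 := Finset.pred_card_le_card_erase
    (s := zeroInversions fun p => c (simpleTransposition i p)) (a := (i.1, i.right))
  omega

theorem card_zeroInversions_swap_le_of_not (i : AdjPos n) (c : Fin n → ℕ)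
    (h : ¬ (c i.1 ≠ 0 ∧ c i.right = 0)) :
    (zeroInversions fun p => c (simpleTransposition i p)).card ≤ (zeroInversions c).card := by
  have h1 := card_erase_zeroInversions_le i c
  have h2 := Finset.card_erase_le (s := zeroInversions c) (a := (i.1, i.right))
  rw [Finset.erase_eq_of_notMem] at h1
  · omega
  · rw [mem_zeroInversions]
    rintro ⟨-, h3, h4⟩
    simp only [simpleTransposition, Equiv.swap_apply_left, Equiv.swap_apply_right] at h3 h4
    exact h ⟨h4, h3⟩

theorem card_zeroInversions_swap_lt (i : AdjPos n) (c : Fin n → ℕ) (hi : c i.1 = 0)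
    (hr : c i.right ≠ 0) :
    (zeroInversions fun p => c (simpleTransposition i p)).card < (zeroInversions c).card := by
  have h1 := card_erase_zeroInversions_le i c
  have h2 : (i.1, i.right) ∈ zeroInversions c := mem_zeroInversions.mpr ⟨i.lt_right, hi, hr⟩
  have h3 := Finset.card_erase_lt_of_mem h2
  rw [Finset.erase_eq_of_notMem] at h1
  · omega
  · rw [mem_zeroInversions]
    rintro ⟨-, h4, -⟩
    simp only [simpleTransposition, Equiv.swap_apply_left] at h4
    exact hr h4

theorem permute_wordProd_nil (c : Fin n → ℕ) : permute (wordProd []) c = c := by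
  funext p
  simp [permute, wordProd]

theorem permute_wordProd_cons (i : AdjPos n) (l : List (AdjPos n)) (c : Fin n → ℕ) :
    permute (wordProd (i :: l)) c =
      fun p => permute (wordProd l) c (simpleTransposition i p) := by
  funext p
  simp [permute, wordProd, simpleTransposition]

theorem card_zeroInversions_permute_le (l : List (AdjPos n)) (c : Fin n → ℕ) :
    (zeroInversions (permute (wordProd l) c)).card ≤ (zeroInversions c).card + l.length := by
  induction l with
  | nil => simp [permute_wordProd_nil]
  | cons i l ih =>
    rw [permute_wordProd_cons, List.length_cons]
    have := card_zeroInversions_swap_le i (permute (wordProd l) c)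
    omega

/-- Each letter adds at most one zero inversion. The length bound leaves no slack, so every letter
meets a nonzero entry followed by a zero, which is the case covered by `quasiTheta_refinementSum`.
-/
theorem quasiThetaWord_refinementSum (l : List (AdjPos n)) {c : Fin n → ℕ}
    (hc : zeroInversions c = ∅)
    (hl : l.length ≤ (zeroInversions (permute (wordProd l) c)).card) :
    quasiThetaWord l (refinementSum c) = refinementSum (permute (wordProd l) c) := by
  induction l with
  | nil => rw [permute_wordProd_nil]; rfl
  | cons i l ih =>
    rw [permute_wordProd_cons, List.length_cons] at hl
    have h1 := card_zeroInversions_permute_le l c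
    rw [hc, Finset.card_empty, zero_add] at h1
    have h2 := card_zeroInversions_swap_le i (permute (wordProd l) c)
    have h3 : permute (wordProd l) c i.1 ≠ 0 ∧ permute (wordProd l) c i.right = 0 := by
      by_contra h
      have := card_zeroInversions_swap_le_of_not i (permute (wordProd l) c) h
      omega
    rw [permute_wordProd_cons, ← quasiTheta_refinementSum i h3.1 h3.2, ← ih (by omega)]
    rfl

/-- With all zeros at the right end, no nonzero entry has a zero to its left to spread into. -/
theorem refinementSum_eq_monomial {c : Fin n → ℕ} (hc : zeroInversions c = ∅) :
    refinementSum c = monomial (Finsupp.equivFunOnFinite.symm c) 1 := by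
  classical
  ext m
  rw [coeff_refinementSum, coeff_monomial]
  refine if_congr ?_ rfl rfl
  have hz : ∀ p q, p < q → c p = 0 → c q = 0 := by
    intro p q hpq hp
    by_contra hq
    have : (p, q) ∈ zeroInversions c := mem_zeroInversions.mpr ⟨hpq, hp, hq⟩
    simp [hc] at this
  constructor
  · intro h
    rw [isRefinement_iff] at h
    ext q
    rw [Finsupp.equivFunOnFinite_symm_apply_apply]
    by_cases hq : c q = 0
    · rw [hq, h.2.2 q]
      rintro r ⟨hqr, hr, -⟩
      rcases hqr.lt_or_eq with hlt | rfl
      · exact hr (hz q r hlt hq)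
      · exact hr hq
    · rw [← h.2.1 q hq, Finset.sum_eq_single q]
      · intro p hp hpq
        rw [Finset.mem_filter] at hp
        have hlt := lt_of_le_of_ne hp.2.1 hpq
        exact absurd (hz p q hlt (hp.2.2.2 p le_rfl hlt)) hq
      · intro h'
        exact absurd (by simpa using nextNonzero_self hq) h'
  · rintro rfl
    exact ⟨fun q hq => ⟨hq, rfl⟩, rfl⟩

theorem flat_eq_zero_of_lt (α : Fin n → ℕ) {p q : Fin n} (hpq : p < q) (hp : flat α p = 0) :
    flat α q = 0 := by
  rw [flat] at hp ⊢
  refine List.getD_eq_default _ _ (le_trans ?_ (Fin.le_def.mp hpq.le))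
  by_contra hlt
  rw [not_le] at hlt
  rw [List.getD_eq_getElem _ _ hlt] at hp
  have := List.getElem_mem hlt
  rw [hp] at this
  simp at this

theorem zeroInversions_flat (α : Fin n → ℕ) : zeroInversions (flat α) = ∅ := by
  refine Finset.eq_empty_of_forall_notMem fun x hx => ?_
  obtain ⟨h1, h2, h3⟩ := mem_zeroInversions.mp hx
  exact h3 (flat_eq_zero_of_lt α h1 h2)

theorem getD_filter_ne_zero {L : List ℕ} (h : L.Pairwise fun a b => a = 0 → b = 0) (k : ℕ) :
    (L.filter (fun a => a ≠ 0)).getD k 0 = L.getD k 0 := by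
  induction L generalizing k with
  | nil => rfl
  | cons a t ih =>
    rw [List.pairwise_cons] at h
    by_cases ha : a = 0
    · have ht : ∀ b ∈ t, b = 0 := fun b hb => h.1 b hb ha
      have hf : (a :: t).filter (fun a => a ≠ 0) = [] := by
        rw [List.filter_eq_nil_iff]
        intro b hb
        rcases List.mem_cons.mp hb with rfl | hb
        · simp [ha]
        · simp [ht b hb]
      rw [hf, List.getD_nil]
      rcases lt_or_ge k (a :: t).length with hk | hk
      · rw [List.getD_eq_getElem _ _ hk]
        rcases List.mem_cons.mp (List.getElem_mem hk) with h' | h'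
        · rw [h', ha]
        · rw [ht _ h']
      · rw [List.getD_eq_default _ _ hk]
    · rw [List.filter_cons_of_pos (by simpa using ha)]
      cases k with
      | zero => rfl
      | succ k => simpa using ih h.2 k

theorem flat_eq_self {α : Fin n → ℕ} (h : ∀ p q, p < q → α p = 0 → α q = 0) : flat α = α := by
  funext p
  rw [flat, getD_filter_ne_zero, List.getD_eq_getElem _ _ (by simp)]
  · simp
  · rw [List.pairwise_ofFn]
    exact fun p q hpq => h p q hpq

theorem flat_swap (i : AdjPos n) {α : Fin n → ℕ} (hi : α i.1 = 0) :
    flat (fun p => α (simpleTransposition i p)) = flat α := by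
  have hsplit : ∀ c : Fin n → ℕ, List.ofFn c = (List.ofFn c).take i.1 ++
      c i.1 :: c i.right :: (List.ofFn c).drop (i.1 + 1 + 1) := by
    intro c
    conv_lhs => rw [← List.take_append_drop i.1.val (List.ofFn c)]
    rw [List.drop_eq_getElem_cons (by simp), List.drop_eq_getElem_cons (by simpa using i.2)]
    simp [AdjPos.right]
  have hoff : ∀ p, p ≠ i.1 → p ≠ i.right → α (simpleTransposition i p) = α p := fun p h h' => by
    rw [simpleTransposition, Equiv.swap_apply_of_ne_of_ne h h']
  have htake : (List.ofFn fun p => α (simpleTransposition i p)).take i.1 =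
      (List.ofFn α).take i.1 := by
    apply List.ext_getElem
    · simp
    · intro k hk hk'
      have hki : k < i.1.val := by
        rw [List.length_take] at hk
        omega
      simp only [List.getElem_take, List.getElem_ofFn]
      refine hoff _ ?_ ?_
      · rw [ne_eq, Fin.ext_iff]
        exact hki.ne
      · rw [ne_eq, Fin.ext_iff]
        simp only [AdjPos.right]
        omega
  have hdrop : (List.ofFn fun p => α (simpleTransposition i p)).drop (i.1 + 1 + 1) =
      (List.ofFn α).drop (i.1 + 1 + 1) := by
    apply List.ext_getElem
    · simp
    · intro k hk hk'
      simp only [List.getElem_drop, List.getElem_ofFn]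
      refine hoff _ ?_ ?_
      · rw [ne_eq, Fin.ext_iff]
        simp only
        omega
      · rw [ne_eq, Fin.ext_iff]
        simp only [AdjPos.right]
        omega
  funext p
  rw [flat, flat, hsplit α, hsplit fun p => α (simpleTransposition i p), htake, hdrop]
  simp only [simpleTransposition, Equiv.swap_apply_left, Equiv.swap_apply_right, hi]
  simp [List.filter_cons]

/-- Bubble sort: as long as a zero stands directly before a nonzero entry, exchanging them removes a
zero inversion and keeps the flat. -/
theorem exists_sorting_word (α : Fin n → ℕ) :
    ∃ l : List (AdjPos n), permute (wordProd l) (flat α) = α ∧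
      l.length ≤ (zeroInversions α).card := by
  induction hd : (zeroInversions α).card using Nat.strong_induction_on generalizing α with
  | _ d ih =>
    by_cases h : ∃ i : AdjPos n, α i.1 = 0 ∧ α i.right ≠ 0
    · obtain ⟨i, hi, hr⟩ := h
      have hlt := card_zeroInversions_swap_lt i α hi hr
      obtain ⟨l, hl, hlen⟩ := ih _ (hd ▸ hlt) (fun p => α (simpleTransposition i p)) rfl
      refine ⟨i :: l, ?_, ?_⟩
      · rw [permute_wordProd_cons, ← flat_swap i hi, hl]
        funext p
        simp only [simpleTransposition_self]
      · rw [List.length_cons]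
        omega
    · push Not at h
      have hz : ∀ k, ∀ p q : Fin n, p.val + k = q.val → α p = 0 → α q = 0 := by
        intro k
        induction k with
        | zero =>
          intro p q hpq hp
          rwa [← Fin.ext (a := p) (b := q) hpq]
        | succ k ihk =>
          intro p q hpq hp
          have hq := q.2
          have h1 : p.val + 1 < n := by omega
          exact ihk (AdjPos.right ⟨p, h1⟩) q (by simp only [AdjPos.right]; omega) (h ⟨p, h1⟩ hp)
      refine ⟨[], ?_, Nat.zero_le _⟩
      rw [flat_eq_self fun p q hpq => hz (q.val - p.val) p q (by rw [Fin.lt_def] at hpq; omega)]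
      exact permute_wordProd_nil α

theorem wordProd_reverse (l : List (AdjPos n)) : wordProd l.reverse = (wordProd l)⁻¹ := by
  have : (simpleTransposition : AdjPos n → Equiv.Perm (Fin n)) =
      (fun w => w⁻¹) ∘ simpleTransposition := by
    funext i
    simp [simpleTransposition]
  rw [wordProd, wordProd, List.prod_inv_reverse, List.map_map, ← this, List.map_reverse]

theorem reducedWord_spec (w : Equiv.Perm (Fin n)) : IsReducedWord (reducedWord w) w :=
  Classical.choose_spec (exists_reducedWord w)

theorem straightening_spec (α : Fin n → ℕ) : permute (straightening α) α = flat α ∧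
    ∀ v : Equiv.Perm (Fin n), permute v α = flat α → permLength (straightening α) ≤ permLength v :=
  Classical.choose_spec (exists_straightening α)

theorem permLength_wordProd_le (l : List (AdjPos n)) : permLength (wordProd l) ≤ l.length :=
  (reducedWord_spec _).2 l rfl

theorem permLength_inv_le (w : Equiv.Perm (Fin n)) : permLength w⁻¹ ≤ permLength w := by
  have h := permLength_wordProd_le (reducedWord w).reverse
  rwa [wordProd_reverse, (reducedWord_spec w).1, List.length_reverse] at h

/-- Minimality of `straightening α` is used only through the length of the chosen word: it is at
most the number of zero inversions of `α`, by comparison with a sorting word. Hence the choice of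
reduced word does not matter. -/
theorem atom_eq_refinementSum (α : Fin n → ℕ) : atom α = refinementSum α := by
  obtain ⟨hw, hmin⟩ := straightening_spec α
  have hperm : permute (wordProd (reducedWord (straightening α)⁻¹)) (flat α) = α := by
    rw [(reducedWord_spec _).1, ← hw]
    funext p
    simp [permute]
  have hlen : (reducedWord (straightening α)⁻¹).length ≤ (zeroInversions α).card := by
    obtain ⟨l, hl, hlen⟩ := exists_sorting_word α
    have hv : permute (wordProd l)⁻¹ α = flat α := by
      conv_lhs => rw [← hl]
      funext p
      simp [permute]
    calc permLength (straightening α)⁻¹ ≤ permLength (straightening α) := permLength_inv_le _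
      _ ≤ permLength (wordProd l)⁻¹ := hmin _ hv
      _ ≤ permLength (wordProd l) := permLength_inv_le _
      _ ≤ l.length := permLength_wordProd_le l
      _ ≤ _ := hlen
  have hz := zeroInversions_flat α
  rw [atom, ← refinementSum_eq_monomial hz, quasiThetaWord_refinementSum _ hz (by rwa [hperm]),
    hperm]

end Words

/-! ### The product formula -/

theorem atom_mul_atom {n : ℕ} (α β : Fin n → ℕ) :
    atom α * atom β = ∑ S ∈ (qamp_finite α β).toFinset, (-1) ^ sgn S * atom (wt S) := by
  classical
  simp only [atom_eq_refinementSum]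
  ext m
  rw [coeff_mul, coeff_sum]
  have hR : ∀ S : Fin n → Multiset (Letter n),
      coeff m ((-1) ^ sgn S * refinementSum (wt S)) =
        if IsRefinement (wt S) m then (-1 : ℂ) ^ sgn S else 0 := by
    intro S
    rw [show ((-1) ^ sgn S : MvPolynomial (Fin n) ℂ) = C ((-1) ^ sgn S) by simp, coeff_C_mul,
      coeff_refinementSum, mul_ite, mul_one, mul_zero]
  simp only [hR, coeff_refinementSum, ite_mul, one_mul, zero_mul, ← ite_and]
  rw [← Finset.sum_filter, ← Finset.sum_filter, Finset.sum_const, nsmul_eq_mul, mul_one]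
  -- Both coefficients of `x^m` are evaluated through the signed sum over loose atom partitions of
  -- weight `m`.
  have h := (sum_qamp_eq α β m).trans (sum_loose_eq_card α β m)
  convert h.symm

end FundamentalAtom

theorem mainTheorem1 (n : ℕ) (α β : Fin n → ℕ) :
    FundamentalAtom.atom α * FundamentalAtom.atom β =
        ∑ S ∈ (FundamentalAtom.qamp_finite α β).toFinset,
          (-1) ^ FundamentalAtom.sgn S * FundamentalAtom.atom (FundamentalAtom.wt S) ∧
      ∀ S ∈ FundamentalAtom.qamp α β, ∀ T ∈ FundamentalAtom.qamp α β,
        FundamentalAtom.wt S = FundamentalAtom.wt T →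
          (-1 : ℤ) ^ FundamentalAtom.sgn S = (-1) ^ FundamentalAtom.sgn T :=
  ⟨FundamentalAtom.atom_mul_atom α β, fun _ hS _ hT h => by
    rw [FundamentalAtom.sgn_eq_of_wt_eq hS hT h]⟩
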